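/- **Setting.** Let $H=D_0+\sum_{j=1}^M D_jP_j$ be a Hermitian matrix, acting on a nonempty finite basis $\{|z\rangle\}$, in permutation matrix representation: $D_0$ is real diagonal, the $D_j$ are diagonal, and the $P_j$ are distinct non-identity elements of an abelian permutation group acting simply transitively on the basis. Let $\beta>0$, $\langle A\rangle=\mathrm{Tr}[Ae^{-\beta H}]/\mathrm{Tr}[e^{-\beta H}]$ and $A(\tau)=e^{\tau H}Ae^{-\tau H}$. For a driving term $H_1$ the (finite-temperature) fidelity susceptibility is $\chi_F^{H_1}=\int_0^{\beta/2}\tau\,(\langle H_1(\tau)H_1\rangle-\langle H_1\rangle^2)\,d\tau$. For complex $t$ and a multiset $[x_0,\dots,x_q]$, let $e^{t[x_0,\dots,x_q]}=\frac1{2\pi i}\oint\frac{e^{tx}}{\prod_{i}(x-x_i)}dx$ (contour around all the $x_i$) be the divided difference of $x\mapsto e^{tx}$; it is $0$ for the empty multiset. A configuration $\mathcal C$ consists of a basis state $z$ and a sequence $i_1,\dots,i_q$ ($q\ge0$) with $P_{i_q}\cdots P_{i_1}=1$. Put $z_k=P_{i_k}\cdots P_{i_1}z$ (so $z_0=z$),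 $E_{z_k}=\langle z_k|D_0|z_k\rangle$, $w_{\mathcal C}=\big(\prod_{k=1}^q\langle z_k|D_{i_k}|z_k\rangle\big)\,e^{-\beta[E_{z_0},\dots,E_{z_q}]}$, and write $O_{\mathcal C}\mathrel{\widehat=}A$ if $\sum_{\mathcal C} w_{\mathcal C}$ and $\sum_{\mathcal C} w_{\mathcal C}O_{\mathcal C}$ converge absolutely, the former is nonzero, and $\overline{O}:=\sum_{\mathcal C} w_{\mathcal C}O_{\mathcal C}/\sum_{\mathcal C} w_{\mathcal C}=A$. **Theorem (an $O(q^3)$ estimator for the fidelity susceptibility).** Let $$F_{\mathcal C}=\mathbf 1_{q=0}\frac{(\beta E_{z_0})^2}{8}+\mathbf 1_{q>0}\frac{E_{z_0}}{e^{-\beta[E_{z_0},\dots,E_{z_q}]}}\sum_{r=0}^q e^{-\frac\beta2[E_{z_0},\dots,E_{z_r}]}\Big(\frac{\beta^2}{8}E_{z_r}e^{-\frac\beta2[E_{z_r},\dots,E_{z_q}]}+\frac{\beta^2}{8}e^{-\frac\beta2[E_{z_{r+1}},\dots,E_{z_q}]}-\sum_{i=r+1}^q(i-r)\,e^{-\frac\beta2[E_{z_r},\dots,E_{z_q},E_{z_i}]}\Big).$$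 Then $F_{\mathcal C}\mathrel{\widehat=}\int_0^{\beta/2}\tau\langle D_0(\tau)D_0\rangle\,d\tau$. Moreover, with $T=e^{-\beta[E_{z_0},\dots,E_{z_q}]}$, $$d_{\mathcal C}=E_{z_0}\mathrel{\widehat=}\langle D_0\rangle,\qquad g_{\mathcal C}=\mathbf 1_{q\ge1}\frac{e^{-\beta[E_{z_0},\dots,E_{z_{q-1}}]}}{T}\mathrel{\widehat=}\langle H-D_0\rangle,\qquad m_{\mathcal C}=E_{z_0}\Big(E_{z_0}+\mathbf 1_{q\ge1}\frac{e^{-\beta[E_{z_1},\dots,E_{z_q}]}}{T}\Big)\mathrel{\widehat=}\langle D_0H\rangle,$$ $$h_{\mathcal C}=E_{z_q}^2+\frac{\mathbf 1_{q\ge1}(E_{z_q}+E_{z_{q-1}})e^{-\beta[E_{z_0},\dots,E_{z_{q-1}}]}+\mathbf 1_{q\ge2}e^{-\beta[E_{z_0},\dots,E_{z_{q-2}}]}}{T}\mathrel{\widehat=}\langle H^2\rangle,$$ and the fidelity susceptibility is given, for real $c$, by $$\chi_F^{H_1}=c^2\Big(\overline F-\tfrac{\beta^2}{8}\,\overline d^{\,2}\Big)\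 \text{ if }H_1=cD_0,\qquad \chi_F^{H_1}=c^2\Big(\overline F+\tfrac{\beta^2}{8}\big(\overline h-2\,\overline m-\overline g^{\,2}\big)\Big)\ \text{ if }H_1=c(H-D_0).$$ Finally, all these estimators can be evaluated in $O(q^3)$ time: there are a single program and a constant $K$ such that for all $\beta>0$, $q\ge0$ and all real energies $E_{z_0},\dots,E_{z_q}$, the program, given $\beta$, $q$ and these energies, outputs $F_{\mathcal C},d_{\mathcal C},g_{\mathcal C},h_{\mathcal C},m_{\mathcal C}$ after at most $K(q+1)^3$ steps. Here time is counted on a random access machine with exact arithmetic and divided-difference calculators, on which adding an input to, or removing one from, a divided difference $e^{t[x_0,\dots,x_n]}$ costs a number of steps linear in the number of inputs, and each elementary scalar or index operation and each access to a stored value costs one step. -/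

import Mathlib

noncomputable section

namespace PMRQMC

/-! ### Divided differences of the exponential -/

/-- The divided difference `e^{t[x₀,…,x_q]}` of `x ↦ e^{t x}` on the multiset `s = [x₀,…,x_q]`:
`(2πi)⁻¹ ∮ e^{t x} / ∏ᵢ (x - xᵢ) dx` over a positively oriented circle enclosing all the `xᵢ`.
On the empty multiset the integrand is entire and the value is `0`. -/
def ddExp (t : ℂ) (s : Multiset ℂ) : ℂ :=
  (2 * (Real.pi : ℂ) * Complex.I)⁻¹ *
    ∮ x in C(0, 1 + (s.map (fun y => ‖y‖)).sum),
      Complex.exp (t * x) / (s.map (fun y => x - y)).prod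

/-- The multiset `[E_a, …, E_b]` (empty when `b < a`). -/
def seg (E : ℕ → ℝ) (a b : ℕ) : Multiset ℂ :=
  (Finset.Icc a b).val.map (fun k => (E k : ℂ))

/-! ### Estimators, as functions of `β`, the order `q` and the energies `E 0, …, E q` -/

/-- The closed-form estimator of `∫₀^{β/2} τ ⟨D₀(τ) D₀⟩ dτ`. -/
def fsEst (β : ℝ) (q : ℕ) (E : ℕ → ℝ) : ℂ :=
  if q = 0 then ((β : ℂ) * E 0) ^ 2 / 8
  else
    (E 0 : ℂ) / ddExp (-β) (seg E 0 q) *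
      ∑ r ∈ Finset.range (q + 1), ddExp (-β / 2) (seg E 0 r) *
        ((β : ℂ) ^ 2 / 8 * E r * ddExp (-β / 2) (seg E r q)
          + (β : ℂ) ^ 2 / 8 * ddExp (-β / 2) (seg E (r + 1) q)
          - ∑ i ∈ Finset.Icc (r + 1) q,
              ((i : ℂ) - (r : ℂ)) * ddExp (-β / 2) ((E i : ℂ) ::ₘ seg E r q))

/-- The estimator of `⟨D₀⟩`. -/
def d0Est (_β : ℝ) (_q : ℕ) (E : ℕ → ℝ) : ℂ := (E 0 : ℂ)

/-- The estimator of `⟨H - D₀⟩`. -/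
def offEst (β : ℝ) (q : ℕ) (E : ℕ → ℝ) : ℂ :=
  if 1 ≤ q then ddExp (-β) (seg E 0 (q - 1)) / ddExp (-β) (seg E 0 q) else 0

/-- The estimator of `⟨H²⟩`. -/
def hsqEst (β : ℝ) (q : ℕ) (E : ℕ → ℝ) : ℂ :=
  (E q : ℂ) ^ 2 +
    ((if 1 ≤ q then ((E q : ℂ) + E (q - 1)) * ddExp (-β) (seg E 0 (q - 1)) else 0)
      + (if 2 ≤ q then ddExp (-β) (seg E 0 (q - 2)) else 0)) / ddExp (-β) (seg E 0 q)

/-- The estimator of `⟨D₀ H⟩`. -/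
def d0hEst (β : ℝ) (q : ℕ) (E : ℕ → ℝ) : ℂ :=
  (E 0 : ℂ) *
    ((E 0 : ℂ) +
      if 1 ≤ q then ddExp (-β) (seg E 1 q) / ddExp (-β) (seg E 0 q) else 0)

/-! ### Hamiltonians in permutation matrix representation -/

/-- Data of a permutation matrix representation `H = D₀ + ∑ⱼ Dⱼ Pⱼ` on the basis `{|z⟩ : z ∈ ι}`:
the `Pⱼ` are distinct non-identity elements of an abelian permutation group `G` that acts simply
transitively on the basis, `D₀` is a real diagonal and the `Dⱼ` are diagonals. -/
structure PMR (ι : Type*) (M : ℕ) where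
  G : Subgroup (Equiv.Perm ι)
  comm : ∀ g ∈ G, ∀ h ∈ G, g * h = h * g
  simplyTransitive : ∀ x y : ι, ∃! g : Equiv.Perm ι, g ∈ G ∧ g x = y
  P : Fin M → Equiv.Perm ι
  P_mem : ∀ j, P j ∈ G
  P_ne_one : ∀ j, P j ≠ 1
  P_injective : Function.Injective P
  D₀ : ι → ℝ
  D : Fin M → ι → ℂ

/-- The matrix of a permutation: `|z⟩ ↦ |σ z⟩`. -/
def permMat {ι : Type*} [DecidableEq ι] (σ : Equiv.Perm ι) : Matrix ι ι ℂ :=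
  Matrix.of fun x z => if σ z = x then 1 else 0

namespace PMR

variable {ι : Type*} {M : ℕ}

/-- The diagonal part `D₀` as a matrix. -/
def diagMat [DecidableEq ι] (H : PMR ι M) : Matrix ι ι ℂ :=
  Matrix.diagonal fun z => (H.D₀ z : ℂ)

/-- The Hamiltonian `H = D₀ + ∑ⱼ Dⱼ Pⱼ` as a matrix. -/
def mat [Fintype ι] [DecidableEq ι] (H : PMR ι M) : Matrix ι ι ℂ :=
  H.diagMat + ∑ j, Matrix.diagonal (H.D j) * permMat (H.P j)

/-- The product `P_{i_k} ⋯ P_{i_1}` of the permutations with indices `[i_1, …, i_k]`. -/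
def permProd (H : PMR ι M) (l : List (Fin M)) : Equiv.Perm ι :=
  ((l.map H.P).reverse).prod

/-- A configuration `(z, S)`: a basis state and a sequence `i_1, …, i_q` of indices (of any
length `q ≥ 0`) such that `S = P_{i_q} ⋯ P_{i_1}` is the identity. -/
structure Config (H : PMR ι M) where
  z : ι
  idx : List (Fin M)
  closed : H.permProd idx = 1

namespace Config

variable {H : PMR ι M}

/-- The order `q`. -/
def q (C : H.Config) : ℕ := C.idx.length

/-- The basis state `z_k = P_{i_k} ⋯ P_{i_1} z`. -/
def state (C : H.Config) (k : ℕ) : ι := H.permProd (C.idx.take k) C.z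

/-- The diagonal energy `E_{z_k} = ⟨z_k|D₀|z_k⟩`. -/
def energy (C : H.Config) (k : ℕ) : ℝ := H.D₀ (C.state k)

/-- The hopping strength `∏_{k=1}^q ⟨z_k|D_{i_k}|z_k⟩`. -/
def hop (C : H.Config) : ℂ :=
  ∏ k : Fin C.idx.length, H.D (C.idx.get k) (C.state (k + 1))

/-- The weight `w_C = D_{(z,S)} e^{-β[E_{z_0},…,E_{z_q}]}`. -/
def weight (β : ℝ) (C : H.Config) : ℂ := C.hop * ddExp (-β) (seg C.energy 0 C.q)

end Config

/-- The value at the configuration `C` of an estimator given by a formula in `β`, `q` and the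
diagonal energies. -/
def atConfig (H : PMR ι M) (β : ℝ) (f : ℝ → ℕ → (ℕ → ℝ) → ℂ) (C : H.Config) : ℂ :=
  f β C.q C.energy

/-- The weighted mean `∑_C w_C O_C / ∑_C w_C`. -/
def mean (H : PMR ι M) (β : ℝ) (O : H.Config → ℂ) : ℂ :=
  (∑' C : H.Config, C.weight β * O C) / ∑' C : H.Config, C.weight β

/-- `O` is an (exact) estimator of `A`: both series converge absolutely, the normalization does not
vanish, and `∑_C w_C O_C / ∑_C w_C = A`. -/
def IsEstimator (H : PMR ι M) (β : ℝ) (O : H.Config → ℂ) (A : ℂ) : Prop :=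
  Summable (fun C : H.Config => ‖C.weight β‖) ∧
  Summable (fun C : H.Config => ‖C.weight β * O C‖) ∧
  ∑' C : H.Config, C.weight β ≠ 0 ∧
  H.mean β O = A

end PMR

/-! ### Thermal averages and the fidelity susceptibility -/

section Thermal

variable {ι : Type*} [Fintype ι] [DecidableEq ι]

/-- The thermal average `⟨A⟩ = Tr[A e^{-βH}] / Tr[e^{-βH}]`. -/
def thermalAvg (H : Matrix ι ι ℂ) (β : ℝ) (A : Matrix ι ι ℂ) : ℂ :=
  (A * NormedSpace.exp (-(β : ℂ) • H)).trace / (NormedSpace.exp (-(β : ℂ) • H)).trace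

/-- Imaginary time evolution `A(τ) = e^{τH} A e^{-τH}`. -/
def evolve (H : Matrix ι ι ℂ) (τ : ℝ) (A : Matrix ι ι ℂ) : Matrix ι ι ℂ :=
  NormedSpace.exp ((τ : ℂ) • H) * A * NormedSpace.exp (-(τ : ℂ) • H)

/-- The fidelity susceptibility
`χ_F = ∫₀^{β/2} τ (⟨H₁(τ) H₁⟩ - ⟨H₁⟩²) dτ` of the driving term `H₁`. -/
def fidSus (H : Matrix ι ι ℂ) (β : ℝ) (H₁ : Matrix ι ι ℂ) : ℂ :=
  ∫ τ in (0 : ℝ)..(β / 2),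
    (τ : ℂ) * (thermalAvg H β (evolve H τ H₁ * H₁) - thermalAvg H β H₁ ^ 2)

end Thermal

/-! ### A machine model that counts steps

A random access machine over `ℂ` with index registers, scalar registers, an array, and
divided-difference calculators. A calculator holds a parameter `t` and a multiset of inputs;
adding or removing one input costs time linear in the number of inputs it holds, and every other
instruction costs one step. -/

/-- The state of the machine. -/
structure State where
  /-- index registers -/
  ix : ℕ → ℕ
  /-- scalar registers -/
  reg : ℕ → ℂ
  /-- array of scalars, addressed through index registers -/
  arr : ℕ → ℂ
  /-- parameter of each calculator -/
  par : ℕ → ℂ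
  /-- inputs of each calculator -/
  inp : ℕ → Multiset ℂ

/-- Instructions; the numbers `a b c`, `u v w`, `k` are fixed names of index registers, scalar
registers and calculators. -/
inductive Instr where
  | ixConst (a n : ℕ)
  | ixAdd (a b c : ℕ)
  | ixSub (a b c : ℕ)
  | const (u : ℕ) (x : ℚ)
  | add (u v w : ℕ)
  | sub (u v w : ℕ)
  | mul (u v w : ℕ)
  | div (u v w : ℕ)
  | load (u a : ℕ)
  | store (a u : ℕ)
  | ddNew (k u : ℕ)
  | ddAdd (k u : ℕ)
  | ddRemove (k u : ℕ)
  | ddRead (u k : ℕ)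

/-- The effect of an instruction. -/
def Instr.exec : Instr → State → State
  | .ixConst a n, s => { s with ix := Function.update s.ix a n }
  | .ixAdd a b c, s => { s with ix := Function.update s.ix a (s.ix b + s.ix c) }
  | .ixSub a b c, s => { s with ix := Function.update s.ix a (s.ix b - s.ix c) }
  | .const u x, s => { s with reg := Function.update s.reg u (x : ℂ) }
  | .add u v w, s => { s with reg := Function.update s.reg u (s.reg v + s.reg w) }
  | .sub u v w, s => { s with reg := Function.update s.reg u (s.reg v - s.reg w) }
  | .mul u v w, s => { s with reg := Function.update s.reg u (s.reg v * s.reg w) }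
  | .div u v w, s => { s with reg := Function.update s.reg u (s.reg v / s.reg w) }
  | .load u a, s => { s with reg := Function.update s.reg u (s.arr (s.ix a)) }
  | .store a u, s => { s with arr := Function.update s.arr (s.ix a) (s.reg u) }
  | .ddNew k u, s =>
      { s with par := Function.update s.par k (s.reg u), inp := Function.update s.inp k 0 }
  | .ddAdd k u, s => { s with inp := Function.update s.inp k (s.reg u ::ₘ s.inp k) }
  | .ddRemove k u, s => { s with inp := Function.update s.inp k ((s.inp k).erase (s.reg u)) }
  | .ddRead u k, s => { s with reg := Function.update s.reg u (ddExp (s.par k) (s.inp k)) }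

/-- The number of steps an instruction takes. -/
def Instr.cost : Instr → State → ℕ
  | .ddAdd k _, s => (s.inp k).card + 1
  | .ddRemove k _, s => (s.inp k).card + 1
  | _, _ => 1

/-- Programs: instructions, composition, a test of an index register against zero, and the
repetition of a program as many times as an index register says on entry. -/
inductive Prog where
  | instr (i : Instr)
  | seq (p r : Prog)
  | ifZero (a : ℕ) (p r : Prog)
  | loop (a : ℕ) (p : Prog)

/-- The final state of a run, and its number of steps. -/
def Prog.run : Prog → State → State × ℕ
  | .instr i, s => (i.exec s, i.cost s)
  | .seq p r, s => ((r.run (p.run s).1).1, (p.run s).2 + (r.run (p.run s).1).2)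
  | .ifZero a p r, s =>
      if s.ix a = 0 then ((p.run s).1, (p.run s).2 + 1) else ((r.run s).1, (r.run s).2 + 1)
  | .loop a p, s =>
      (fun x : State × ℕ => ((p.run x.1).1, x.2 + (p.run x.1).2 + 1))^[s.ix a] (s, 1)

/-- The initial state: index register `0` holds `q`, scalar register `0` holds `β`, the array holds
`E 0, …, E q`, and everything else is blank. -/
def initState (β : ℝ) (q : ℕ) (E : ℕ → ℝ) : State where
  ix := fun a => if a = 0 then q else 0
  reg := fun u => if u = 0 then (β : ℂ) else 0
  arr := fun k => if k ≤ q then (E k : ℂ) else 0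
  par := fun _ => 0
  inp := fun _ => 0

end PMRQMC

end

namespace PMRQMC

open Metric Filter Topology

/-! ### Moments of the divided difference -/

/-! The engine is the off-diagonal series expansion: a matrix element of `H ^ p * exp (t H)` is the
sum, over all sequences of hops joining the two basis states, of the product of hopping strengths
times the divided difference of `x ^ p * exp (t x)` at the energies visited (`hasSum_path_exp`). For
powers of `H` this is an induction. The step out of the initial state either stays (factor `D₀`) or
hops, which is precisely the recursion `ddMoment_succ_cons`. Summing over powers needs absolute
convergence. It comes from `norm_ddMoment_cons_le`, whose free parameter `μ` lets the decay in the
number of nodes beat both the number of paths and the hopping strengths. A trace keeps the closed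
paths, and by simple transitivity these are the configurations. The static estimators then follow by
peeling energies off divided differences of `x * exp (-β x)` and `x ^ 2 * exp (-β x)`.

For the dynamical correlator, cyclicity leaves two exponentials of durations `τ` and `β - τ` around
a `D₀`. Two consecutive paths are one path with a cut `r`, so a configuration contributes `∑ᵣ E_r
e^{-(β-τ)[E_0,…,E_r]} e^{-τ[E_r,…,E_q]}` (`hasSum_path_split`). This must be integrated against `τ`
over half the period. With `T = β/2`, the Leibniz rule `thermalDD_add` applied to `β - τ = T + (T -
τ)` factors out `e^{-T[E_0,…,E_s]}` and leaves an integral over all of `[0, T]`. There, `E_r` is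
absorbed by the recursion, giving a constant minus a sum of products over disjoint adjacent
intervals. That sum is the derivative of a sum with weights `r - s` (`hasDerivAt_weighted_split`).
Integration by parts and the convolution identity `integral_thermalDD_mul` yield the factors `i - r`
and the repeated energy `E_i`.

For `H₁ = c (H - D₀)`, `H` commutes with its exponentials, so the extra terms are independent of `τ`
and are weighted by `∫₀^{β/2} τ dτ = β² / 8`. For the running time, a double loop makes `O(q²)`
calculator updates, each linear in `q`. -/

lemma norm_le_sum_of_mem {s : Multiset ℂ} {y : ℂ} (hy : y ∈ s) :
    ‖y‖ ≤ (s.map (fun y => ‖y‖)).sum :=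
  Multiset.single_le_sum (by simp only [Multiset.mem_map]; rintro _ ⟨a, -, rfl⟩; positivity) _
    (Multiset.mem_map_of_mem _ hy)

lemma radius_pos (s : Multiset ℂ) : 0 < 1 + (s.map (fun y => ‖y‖)).sum := by
  have : 0 ≤ (s.map (fun y => ‖y‖)).sum :=
    Multiset.sum_nonneg (by simp only [Multiset.mem_map]; rintro _ ⟨a, -, rfl⟩; positivity)
  linarith

lemma prod_sub_ne_zero {s : Multiset ℂ} {r : ℝ} (hs : ∀ y ∈ s, ‖y‖ < r) {x : ℂ} (hx : r ≤ ‖x‖) :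
    (s.map (fun y => x - y)).prod ≠ 0 := by
  rw [Ne, Multiset.prod_eq_zero_iff, Multiset.mem_map]
  rintro ⟨y, hy, h⟩
  have := hs y hy
  rw [sub_eq_zero.1 h] at hx
  linarith

lemma differentiable_prod_sub (s : Multiset ℂ) :
    Differentiable ℂ (fun x : ℂ => (s.map (fun y => x - y)).prod) := by
  induction s using Multiset.induction_on with
  | empty => simp
  | cons a s ih =>
    simp only [Multiset.map_cons, Multiset.prod_cons]
    exact (differentiable_id.sub_const a).mul ih

/-- The contour integral does not depend on the radius. -/
lemma circleIntegral_div_prod_eq {f : ℂ → ℂ} (hf : Differentiable ℂ f) {s : Multiset ℂ} {r R : ℝ}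
    (hr : 0 < r) (hrR : r ≤ R) (hs : ∀ y ∈ s, ‖y‖ < r) :
    (∮ x in C(0, R), f x / (s.map (fun y => x - y)).prod) =
      ∮ x in C(0, r), f x / (s.map (fun y => x - y)).prod := by
  have hd : ∀ x : ℂ, r ≤ ‖x‖ →
      DifferentiableAt ℂ (fun x => f x / (s.map (fun y => x - y)).prod) x := fun x hx =>
    (hf x).div (differentiable_prod_sub s x) (prod_sub_ne_zero hs hx)
  refine Complex.circleIntegral_eq_of_differentiable_on_annulus_off_countable hr hrR
    (s := ∅) Set.countable_empty (fun x hx => ?_) (fun x hx => ?_)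
  · refine (hd x ?_).continuousAt.continuousWithinAt
    simpa using hx.2
  · refine hd x ?_
    have := hx.1.2
    simp only [mem_closedBall, dist_zero_right, not_le] at this
    exact this.le

lemma continuousOn_div_prod {f : ℂ → ℂ} (hf : Continuous f) {s : Multiset ℂ} {R : ℝ}
    (hs : ∀ y ∈ s, ‖y‖ < R) :
    ContinuousOn (fun x => f x / (s.map (fun y => x - y)).prod) (sphere 0 R) := by
  refine hf.continuousOn.div (differentiable_prod_sub s).continuous.continuousOn fun x hx => ?_
  exact prod_sub_ne_zero hs (by simp at hx; rw [hx])

/-- The divided difference of `x ↦ x ^ k`. -/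
noncomputable def ddMoment (k : ℕ) (s : Multiset ℂ) : ℂ :=
  (2 * (Real.pi : ℂ) * Complex.I)⁻¹ *
    ∮ x in C(0, 1 + (s.map (fun y => ‖y‖)).sum), x ^ k / (s.map (fun y => x - y)).prod

lemma ddMoment_eq (k : ℕ) {s : Multiset ℂ} {R : ℝ} (hR : 1 + (s.map (fun y => ‖y‖)).sum ≤ R) :
    ddMoment k s = (2 * (Real.pi : ℂ) * Complex.I)⁻¹ *
      ∮ x in C(0, R), x ^ k / (s.map (fun y => x - y)).prod := by
  rw [ddMoment, circleIntegral_div_prod_eq (differentiable_pow k) (radius_pos s) hR]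
  intro y hy
  linarith [norm_le_sum_of_mem hy]

@[simp] lemma ddMoment_zero_right (k : ℕ) : ddMoment k 0 = 0 := by
  have : (∮ x in C(0, 1), x ^ k) = 0 :=
    Complex.circleIntegral_eq_zero_of_differentiable_on_off_countable zero_le_one
      Set.countable_empty (continuous_pow k).continuousOn (fun z _ => differentiable_pow k z)
  simp [ddMoment, this]

lemma ddMoment_zero_singleton (a : ℂ) : ddMoment 0 {a} = 1 := by
  have : (∮ x in C(0, 1 + ‖a‖), (x - a)⁻¹) = 2 * Real.pi * Complex.I :=
    circleIntegral.integral_sub_inv_of_mem_ball (by simp)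
  have h2 : (2 * (Real.pi : ℂ) * Complex.I) ≠ 0 := Complex.two_pi_I_ne_zero
  simp only [ddMoment, Multiset.map_singleton, Multiset.sum_singleton, pow_zero,
    Multiset.prod_singleton, one_div, this]
  exact inv_mul_cancel₀ h2

lemma norm_prod_sub_ge {s : Multiset ℂ} {r : ℝ} {x : ℂ} (hr : 0 ≤ r) (hx : ∀ y ∈ s, r ≤ ‖x - y‖) :
    r ^ s.card ≤ ‖(s.map (fun y => x - y)).prod‖ := by
  induction s using Multiset.induction_on with
  | empty => simp
  | cons a s ih =>
    rw [Multiset.card_cons, Multiset.map_cons, Multiset.prod_cons, norm_mul, pow_succ, mul_comm]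
    exact mul_le_mul (hx a (by simp)) (ih fun y hy => hx y (by simp [hy])) (by positivity)
      (norm_nonneg _)

/-- The contour can be pushed to infinity: the integrand is then `O(R⁻²)` against a length `O(R)`.
-/
lemma ddMoment_zero_of_two_le {s : Multiset ℂ} (hs : 2 ≤ s.card) : ddMoment 0 s = 0 := by
  set r := 1 + (s.map (fun y => ‖y‖)).sum with hrdef
  have hr : 0 < r := radius_pos s
  -- On the circle of radius `r + (n + 1)` every node is at distance at least `n + 1`.
  have hb : ∀ n : ℕ, ‖ddMoment 0 s‖ ≤ (r + (n + 1)) * (1 / ((n : ℝ) + 1) ^ 2) := by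
    intro n
    rw [ddMoment_eq 0 (R := r + (n + 1)) (by linarith)]
    refine circleIntegral.norm_two_pi_i_inv_smul_integral_le_of_norm_le_const (by positivity) ?_
    intro x hx
    have hx' : ‖x‖ = r + (n + 1) := by simpa using hx
    have h1 : ((n : ℝ) + 1) ^ s.card ≤ ‖(s.map (fun y => x - y)).prod‖ := by
      refine norm_prod_sub_ge (by positivity) fun y hy => ?_
      have := norm_le_sum_of_mem hy
      have := norm_sub_norm_le x y
      linarith
    have h2 : ((n : ℝ) + 1) ^ 2 ≤ ((n : ℝ) + 1) ^ s.card :=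
      pow_le_pow_right₀ (by linarith [n.cast_nonneg (α := ℝ)]) hs
    rw [norm_div, pow_zero, norm_one]
    exact one_div_le_one_div_of_le (by positivity) (h2.trans h1)
  have hlim : Tendsto (fun n : ℕ => (r + ((n : ℝ) + 1)) * (1 / ((n : ℝ) + 1) ^ 2)) atTop (𝓝 0) := by
    have h1 := tendsto_one_div_add_atTop_nhds_zero_nat (𝕜 := ℝ)
    have h2 := ((h1.mul h1).const_mul r).add h1
    simp only [mul_zero, add_zero] at h2
    refine h2.congr fun n => ?_
    have : (n : ℝ) + 1 ≠ 0 := by positivity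
    field_simp
  have := ge_of_tendsto' hlim hb
  exact norm_le_zero_iff.1 this

/-- Write `x ^ (k + 1) = a * x ^ k + (x - a) * x ^ k`; the factor `x - a` cancels one node. All
three integrals are taken on the circle adapted to the larger multiset. -/
lemma ddMoment_succ_cons (k : ℕ) (a : ℂ) (s : Multiset ℂ) :
    ddMoment (k + 1) (a ::ₘ s) = a * ddMoment k (a ::ₘ s) + ddMoment k s := by
  set R := 1 + ((a ::ₘ s).map (fun y => ‖y‖)).sum with hR
  have hRs : 1 + (s.map (fun y => ‖y‖)).sum ≤ R := by
    simp only [hR, Multiset.map_cons, Multiset.sum_cons]; linarith [norm_nonneg a]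
  have hlt : ∀ y ∈ a ::ₘ s, ‖y‖ < R := fun y hy => by linarith [norm_le_sum_of_mem hy]
  have hlt' : ∀ y ∈ s, ‖y‖ < R := fun y hy => hlt y (by simp [hy])
  have hR0 : 0 ≤ R := (radius_pos _).le
  rw [ddMoment_eq (k + 1) hR.ge, ddMoment_eq k hR.ge, ddMoment_eq k hRs]
  rw [mul_left_comm a, ← mul_add, ← circleIntegral.integral_const_mul a,
    ← circleIntegral.integral_add]
  · congr 1
    refine circleIntegral.integral_congr hR0 fun x hx => ?_
    have hx' : R ≤ ‖x‖ := by simp at hx; rw [hx]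
    have h1 := prod_sub_ne_zero hlt hx'
    have h2 := prod_sub_ne_zero hlt' hx'
    simp only [Multiset.map_cons, Multiset.prod_cons] at h1 ⊢
    have h3 := left_ne_zero_of_mul h1
    field_simp
    ring
  · exact (continuousOn_const.mul
      (continuousOn_div_prod (continuous_pow k) hlt)).circleIntegrable hR0
  · exact (continuousOn_div_prod (continuous_pow k) hlt').circleIntegrable hR0

lemma ddMoment_zero (s : Multiset ℂ) : ddMoment 0 s = if s.card = 1 then 1 else 0 := by
  split_ifs with h
  · obtain ⟨a, rfl⟩ := Multiset.card_eq_one.1 h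
    exact ddMoment_zero_singleton a
  · rcases Nat.lt_or_gt_of_ne h with h | h
    · rw [Nat.lt_one_iff, Multiset.card_eq_zero] at h
      simp [h]
    · exact ddMoment_zero_of_two_le h

/-- In the recursion, multiplying by the node costs `Λ` and dropping it costs `μ`. Since `μ` is
free, it can later be taken large compared with the hopping strengths. -/
lemma norm_ddMoment_cons_le {Λ μ : ℝ} (hμ : 0 ≤ μ) (k : ℕ) (a : ℂ) (s : Multiset ℂ)
    (hs : ∀ y ∈ a ::ₘ s, ‖y‖ ≤ Λ) : ‖ddMoment k (a ::ₘ s)‖ * μ ^ s.card ≤ (Λ + μ) ^ k := by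
  have hΛ : 0 ≤ Λ := (norm_nonneg a).trans (hs a (by simp))
  induction k generalizing a s with
  | zero =>
    rw [ddMoment_zero]
    by_cases h : s = 0 <;> simp [h]
  | succ k ih =>
    rw [ddMoment_succ_cons, pow_succ, mul_comm _ (Λ + μ), add_mul]
    have h1 : ‖a * ddMoment k (a ::ₘ s)‖ * μ ^ s.card ≤ Λ * (Λ + μ) ^ k := by
      rw [norm_mul, mul_assoc]
      exact mul_le_mul (hs a (by simp)) (ih a s hs) (by positivity) hΛ
    have h2 : ‖ddMoment k s‖ * μ ^ s.card ≤ μ * (Λ + μ) ^ k := by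
      rcases s.empty_or_exists_mem with rfl | ⟨b, hb⟩
      · simp only [ddMoment_zero_right, norm_zero, zero_mul]; positivity
      · obtain ⟨s', rfl⟩ := Multiset.exists_cons_of_mem hb
        rw [Multiset.card_cons, pow_succ, mul_comm μ, ← mul_assoc]
        exact mul_le_mul_of_nonneg_right (ih b s' fun y hy => hs y (by simp [hy])) hμ
    calc _ ≤ (‖a * ddMoment k (a ::ₘ s)‖ + ‖ddMoment k s‖) * μ ^ s.card :=
          mul_le_mul_of_nonneg_right (norm_add_le _ _) (by positivity)
      _ ≤ _ := by rw [add_mul]; exact add_le_add h1 h2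

lemma exists_norm_ddMoment_le (s : Multiset ℂ) : ∃ ρ : ℝ, 0 ≤ ρ ∧ ∀ k, ‖ddMoment k s‖ ≤ ρ ^ k := by
  rcases s.empty_or_exists_mem with rfl | ⟨b, hb⟩
  · exact ⟨0, le_rfl, fun k => by simp⟩
  · obtain ⟨s, rfl⟩ := Multiset.exists_cons_of_mem hb
    refine ⟨((b ::ₘ s).map (fun y => ‖y‖)).sum + 1, by linarith [radius_pos (b ::ₘ s)],
      fun k => ?_⟩
    simpa using norm_ddMoment_cons_le zero_le_one k b s fun y hy => norm_le_sum_of_mem hy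

/-! ### Divided differences of `x ^ p * exp (t * x)` -/

/-- The divided difference of `x ↦ x ^ p * exp (t * x)`, as a power series in `t`. -/
noncomputable def ddPowExp (p : ℕ) (t : ℂ) (s : Multiset ℂ) : ℂ :=
  ∑' k : ℕ, t ^ k / (k.factorial : ℂ) * ddMoment (k + p) s

lemma summable_ddPowExp_bound (r ρ : ℝ) (p : ℕ) :
    Summable fun k : ℕ => r ^ k / (k.factorial : ℝ) * ρ ^ (k + p) := by
  refine ((Real.summable_pow_div_factorial (r * ρ)).mul_right (ρ ^ p)).congr fun k => ?_
  rw [mul_pow, pow_add]; ring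

lemma summable_ddPowExp (p : ℕ) (t : ℂ) (s : Multiset ℂ) :
    Summable fun k : ℕ => t ^ k / (k.factorial : ℂ) * ddMoment (k + p) s := by
  obtain ⟨ρ, hρ, h⟩ := exists_norm_ddMoment_le s
  refine Summable.of_norm_bounded (summable_ddPowExp_bound ‖t‖ ρ p) fun k => ?_
  rw [norm_mul, norm_div, norm_pow, Complex.norm_natCast]
  gcongr
  exact h _

lemma hasSum_ddPowExp (p : ℕ) (t : ℂ) (s : Multiset ℂ) :
    HasSum (fun k : ℕ => t ^ k / (k.factorial : ℂ) * ddMoment (k + p) s) (ddPowExp p t s) :=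
  (summable_ddPowExp p t s).hasSum

@[simp] lemma ddPowExp_zero_right (p : ℕ) (t : ℂ) : ddPowExp p t 0 = 0 := by simp [ddPowExp]

lemma ddPowExp_succ_cons (p : ℕ) (t a : ℂ) (s : Multiset ℂ) :
    ddPowExp (p + 1) t (a ::ₘ s) = a * ddPowExp p t (a ::ₘ s) + ddPowExp p t s := by
  refine (hasSum_ddPowExp (p + 1) t (a ::ₘ s)).unique ?_
  refine (((hasSum_ddPowExp p t (a ::ₘ s)).mul_left a).add (hasSum_ddPowExp p t s)).congr_fun ?_
  intro k
  rw [← add_assoc, ddMoment_succ_cons]; ring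

/-- These values settle every boundary term in the later telescoping and integration arguments. -/
lemma ddPowExp_zero_left (s : Multiset ℂ) : ddPowExp 0 0 s = if s.card = 1 then 1 else 0 := by
  rw [ddPowExp, tsum_eq_single 0]
  · simp [ddMoment_zero]
  · intro k hk; simp [hk]

lemma ddPowExp_zero_singleton (t a : ℂ) : ddPowExp 0 t {a} = Complex.exp (t * a) := by
  have h : ∀ k, ddMoment k {a} = a ^ k := by
    intro k
    induction k with
    | zero => simp [ddMoment_zero]
    | succ k ih =>
      have := ddMoment_succ_cons k a 0
      simp only [Multiset.cons_zero, ddMoment_zero_right, add_zero, ih] at this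
      rw [this, pow_succ']
  rw [Complex.exp_eq_exp_ℂ, NormedSpace.exp_eq_tsum_div, ddPowExp]
  refine tsum_congr fun k => ?_
  rw [add_zero, h, mul_pow]; ring

/-- Differentiation in `t` brings down a factor `x`, which is why the family is indexed by `p`. The
series is differentiated termwise with a uniform bound on a ball slightly larger than `‖t‖`. -/
lemma hasDerivAt_ddPowExp (p : ℕ) (s : Multiset ℂ) (t : ℂ) :
    HasDerivAt (fun t => ddPowExp p t s) (ddPowExp (p + 1) t s) t := by
  obtain ⟨ρ, hρ, h⟩ := exists_norm_ddMoment_le s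
  set r := ‖t‖ + 1
  have hr : 0 ≤ r := by positivity
  have hu : Summable (fun k : ℕ => ((k : ℝ) * r ^ (k - 1)) / (k.factorial : ℝ) * ρ ^ (k + p)) := by
    rw [← summable_nat_add_iff 1]
    refine (summable_ddPowExp_bound r ρ (p + 1)).congr fun k => ?_
    rw [Nat.factorial_succ, Nat.add_sub_cancel, Nat.cast_mul, add_assoc, add_comm 1 p]
    have : ((k + 1 : ℕ) : ℝ) ≠ 0 := by positivity
    field_simp
  have := hasDerivAt_tsum_of_isPreconnected (𝕜 := ℂ)
    (g := fun (k : ℕ) t => t ^ k / (k.factorial : ℂ) * ddMoment (k + p) s)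
    (g' := fun (k : ℕ) t => ((k : ℂ) * t ^ (k - 1)) / (k.factorial : ℂ) * ddMoment (k + p) s)
    (y := t) (y₀ := t) (t := ball 0 r) hu isOpen_ball (convex_ball _ _).isPreconnected
    (fun k y _ => ((hasDerivAt_pow k y).div_const _).mul_const _)
    (fun k y hy => by
      have hy' : ‖y‖ ≤ r := by simpa using (mem_ball_zero_iff.1 hy).le
      rw [norm_mul, norm_div, norm_mul, norm_pow, Complex.norm_natCast, Complex.norm_natCast]
      gcongr
      exact h _)
    (by simp [r]) (summable_ddPowExp p t s) (by simp [r])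
  convert! this using 1
  rw [ddPowExp, Summable.tsum_eq_zero_add (f := fun k : ℕ =>
    ((k : ℂ) * t ^ (k - 1)) / (k.factorial : ℂ) * ddMoment (k + p) s)]
  · simp only [Nat.cast_zero, zero_mul, zero_div, zero_add]
    refine tsum_congr fun k => ?_
    rw [Nat.factorial_succ, Nat.add_sub_cancel, Nat.cast_mul, add_assoc k 1, add_comm 1 p]
    have : ((k + 1 : ℕ) : ℂ) ≠ 0 := Nat.cast_ne_zero.2 k.succ_ne_zero
    field_simp
  · refine Summable.of_norm_bounded hu fun k => ?_
    rw [norm_mul, norm_div, norm_mul, norm_pow, Complex.norm_natCast, Complex.norm_natCast]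
    gcongr
    · simp [r]
    · exact h _

lemma norm_ddPowExp_cons_le {Λ μ : ℝ} (hμ : 0 ≤ μ) (p : ℕ) (t a : ℂ) (s : Multiset ℂ)
    (hs : ∀ y ∈ a ::ₘ s, ‖y‖ ≤ Λ) :
    ‖ddPowExp p t (a ::ₘ s)‖ * μ ^ s.card ≤ (Λ + μ) ^ p * Real.exp (‖t‖ * (Λ + μ)) := by
  have hΛ : 0 ≤ Λ := (norm_nonneg a).trans (hs a (by simp))
  have h1 : HasSum (fun k : ℕ => (Λ + μ) ^ p * ((‖t‖ * (Λ + μ)) ^ k / (k.factorial : ℝ)))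
      ((Λ + μ) ^ p * Real.exp (‖t‖ * (Λ + μ))) := by
    rw [Real.exp_eq_exp_ℝ]
    exact (NormedSpace.expSeries_div_hasSum_exp (‖t‖ * (Λ + μ))).mul_left _
  have h2 : ‖ddPowExp p t (a ::ₘ s) * ((μ : ℂ) ^ s.card)‖ ≤
      (Λ + μ) ^ p * Real.exp (‖t‖ * (Λ + μ)) := by
    rw [ddPowExp, ← tsum_mul_right]
    refine tsum_of_norm_bounded h1 fun k => ?_
    rw [norm_mul, norm_mul, norm_div, norm_pow, Complex.norm_natCast, norm_pow, Complex.norm_real,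
      Real.norm_of_nonneg hμ, mul_assoc]
    calc _ ≤ ‖t‖ ^ k / (k.factorial : ℝ) * (Λ + μ) ^ (k + p) := by
          gcongr; exact norm_ddMoment_cons_le hμ _ _ _ hs
      _ = _ := by rw [mul_pow, pow_add]; ring
  rwa [norm_mul, norm_pow, Complex.norm_real, Real.norm_of_nonneg hμ] at h2

/-- The contour integral agrees with the power series. -/
lemma ddExp_eq (t : ℂ) (s : Multiset ℂ) : ddExp t s = ddPowExp 0 t s := by
  set R := 1 + (s.map (fun y => ‖y‖)).sum with hR
  have hlt : ∀ y ∈ s, ‖y‖ < R := fun y hy => by linarith [norm_le_sum_of_mem hy]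
  have hRpos : 0 < R := radius_pos _
  have hcont : ContinuousOn (fun x : ℂ => 1 / (s.map (fun y => x - y)).prod) (sphere 0 R) :=
    continuousOn_div_prod continuous_const hlt
  obtain ⟨C, hC⟩ := (isCompact_sphere (0 : ℂ) R).exists_bound_of_continuousOn hcont
  have hmem : ∀ θ : ℝ, circleMap 0 R θ ∈ sphere (0 : ℂ) R := fun θ =>
    circleMap_mem_sphere _ hRpos.le _
  -- The exponential is expanded under the integral; `C` bounds the reciprocal product on the
  -- circle, so the terms are dominated by an exponential series.
  have key : HasSum (fun k : ℕ => ∮ x in C(0, R), t ^ k / (k.factorial : ℂ) *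
      (x ^ k / (s.map (fun y => x - y)).prod))
      (∮ x in C(0, R), Complex.exp (t * x) / (s.map (fun y => x - y)).prod) := by
    simp only [circleIntegral]
    refine intervalIntegral.hasSum_integral_of_dominated_convergence
      (fun k _ => R * ((‖t‖ * R) ^ k / (k.factorial : ℝ) * C)) (fun k => ?_) (fun k => ?_) ?_ ?_ ?_
    · refine Continuous.aestronglyMeasurable ?_
      have : Continuous fun θ => (fun x : ℂ => x ^ k / (s.map (fun y => x - y)).prod)
          (circleMap 0 R θ) :=
        (continuousOn_div_prod (continuous_pow k) hlt).comp_continuous (continuous_circleMap 0 R) hmem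
      have h2 : Continuous (deriv (circleMap 0 R)) := by
        have : deriv (circleMap 0 R) = fun θ => circleMap 0 R θ * Complex.I :=
          funext fun θ => deriv_circleMap _ _ _
        rw [this]
        exact (continuous_circleMap 0 R).mul continuous_const
      exact h2.smul (continuous_const.mul this)
    · refine Eventually.of_forall fun θ _ => ?_
      have h1 := hC _ (hmem θ)
      rw [norm_smul, deriv_circleMap, norm_mul, Complex.norm_I, mul_one, norm_circleMap_zero,
        abs_of_pos hRpos, ← mul_one_div (circleMap 0 R θ ^ k), ← mul_assoc (t ^ k / _), norm_mul,
        norm_mul, norm_div, norm_pow, norm_pow, Complex.norm_natCast, norm_circleMap_zero,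
        abs_of_pos hRpos, mul_pow]
      have : ‖t‖ ^ k / (k.factorial : ℝ) * R ^ k = ‖t‖ ^ k * R ^ k / (k.factorial : ℝ) := by ring
      rw [this]
      gcongr
    · exact Eventually.of_forall fun θ _ =>
        ((Real.summable_pow_div_factorial _).mul_right _).mul_left _
    · exact intervalIntegrable_const
    · refine Eventually.of_forall fun θ _ => ?_
      have h1 := NormedSpace.expSeries_div_hasSum_exp (t * circleMap 0 R θ)
      rw [← Complex.exp_eq_exp_ℂ] at h1
      have h2 := (h1.div_const ((s.map (fun y => circleMap 0 R θ - y)).prod)).const_smul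
        (deriv (circleMap 0 R) θ)
      refine h2.congr_fun fun k => ?_
      rw [mul_pow]; congr 1; ring
  have h3 := key.mul_left (2 * (Real.pi : ℂ) * Complex.I)⁻¹
  refine (h3.congr_fun fun k => ?_).unique (hasSum_ddPowExp 0 t s)
  rw [circleIntegral.integral_const_mul, ddMoment, ← hR, add_zero]; ring

end PMRQMC

namespace PMRQMC

open Filter Topology intervalIntegral

/-! ### Calculus of divided differences on intervals of energies -/

/-- The multiset `[E_a, …, E_{b-1}]`. -/
def icoSeg (E : ℕ → ℝ) (a b : ℕ) : Multiset ℂ :=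
  (Finset.Ico a b).val.map (fun k => (E k : ℂ))

lemma seg_eq_icoSeg (E : ℕ → ℝ) (a b : ℕ) : seg E a b = icoSeg E a (b + 1) := by
  rw [seg, icoSeg]; congr 2

lemma icoSeg_of_le (E : ℕ → ℝ) {a b : ℕ} (h : b ≤ a) : icoSeg E a b = 0 := by
  simp [icoSeg, Finset.Ico_eq_empty_of_le h]

lemma icoSeg_left (E : ℕ → ℝ) {a b : ℕ} (h : a < b) :
    icoSeg E a b = (E a : ℂ) ::ₘ icoSeg E (a + 1) b := by
  rw [icoSeg, ← Finset.insert_Ico_add_one_left_eq_Ico h, Finset.insert_val_of_notMem (by simp)]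
  simp [icoSeg]

lemma icoSeg_right (E : ℕ → ℝ) {a b : ℕ} (h : a ≤ b) :
    icoSeg E a (b + 1) = (E b : ℂ) ::ₘ icoSeg E a b := by
  rw [icoSeg, ← Finset.insert_Ico_right_eq_Ico_add_one h, Finset.insert_val_of_notMem (by simp)]
  simp [icoSeg]

lemma icoSeg_add (E : ℕ → ℝ) {a b c : ℕ} (hab : a ≤ b) (hbc : b ≤ c) :
    icoSeg E a c = icoSeg E a b + icoSeg E b c := by
  induction c, hbc using Nat.le_induction with
  | base => simp [icoSeg_of_le E le_rfl]
  | succ c hbc ih => rw [icoSeg_right E (hab.trans hbc), icoSeg_right E hbc, ih, Multiset.add_cons]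

lemma icoSeg_congr {E F : ℕ → ℝ} {a b : ℕ} (h : ∀ k, a ≤ k → k < b → E k = F k) :
    icoSeg E a b = icoSeg F a b := by
  refine Multiset.map_congr rfl fun k hk => ?_
  rw [Finset.mem_val, Finset.mem_Ico] at hk
  rw [h k hk.1 hk.2]

lemma icoSeg_shift (E : ℕ → ℝ) (a b c : ℕ) :
    icoSeg (fun k => E (k + c)) a b = icoSeg E (a + c) (b + c) := by
  rcases le_total b a with h | h
  · rw [icoSeg_of_le _ h, icoSeg_of_le _ (by omega)]
  induction b, h using Nat.le_induction with
  | base => rw [icoSeg_of_le _ le_rfl, icoSeg_of_le _ le_rfl]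
  | succ b h ih => rw [icoSeg_right _ h, ih, add_right_comm, icoSeg_right _ (by omega)]

@[simp] lemma card_icoSeg (E : ℕ → ℝ) (a b : ℕ) : (icoSeg E a b).card = b - a := by
  simp [icoSeg]

/-- The divided difference of `x ^ p * exp (-τ * x)` on `[E_a, …, E_{b-1}]`. -/
noncomputable def thermalDD (E : ℕ → ℝ) (p a b : ℕ) (τ : ℝ) : ℂ :=
  ddPowExp p (-(τ : ℂ)) (icoSeg E a b)

variable {E : ℕ → ℝ}

lemma thermalDD_of_le {p a b : ℕ} (h : b ≤ a) (τ : ℝ) : thermalDD E p a b τ = 0 := by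
  rw [thermalDD, icoSeg_of_le E h, ddPowExp_zero_right]

lemma thermalDD_succ_left {p a b : ℕ} (h : a < b) (τ : ℝ) :
    thermalDD E (p + 1) a b τ = E a * thermalDD E p a b τ + thermalDD E p (a + 1) b τ := by
  rw [thermalDD, thermalDD, thermalDD, icoSeg_left E h, ddPowExp_succ_cons]

/-- Nodes are unordered, so the last energy can be peeled off just as well. The case `a = b` is
allowed: the remaining interval is then empty and contributes zero. -/
lemma thermalDD_succ_right {p a b : ℕ} (h : a ≤ b) (τ : ℝ) :
    thermalDD E (p + 1) a (b + 1) τ = E b * thermalDD E p a (b + 1) τ + thermalDD E p a b τ := by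
  rw [thermalDD, thermalDD, thermalDD, icoSeg_right E h, ddPowExp_succ_cons]

lemma thermalDD_at_zero (a b : ℕ) : thermalDD E 0 a b 0 = if b = a + 1 then 1 else 0 := by
  rw [thermalDD, Complex.ofReal_zero, neg_zero, ddPowExp_zero_left, card_icoSeg]
  congr 1
  exact propext (by omega)

lemma hasDerivAt_ddPowExp_neg (p : ℕ) (s : Multiset ℂ) (τ : ℝ) :
    HasDerivAt (fun τ : ℝ => ddPowExp p (-(τ : ℂ)) s) (-ddPowExp (p + 1) (-(τ : ℂ)) s) τ := by
  have h1 := (hasDerivAt_ddPowExp p s (-(τ : ℂ))).comp (τ : ℂ) (hasDerivAt_neg (τ : ℂ))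
  simpa using h1.comp_ofReal

lemma continuous_ddPowExp_neg (p : ℕ) (s : Multiset ℂ) :
    Continuous (fun τ : ℝ => ddPowExp p (-(τ : ℂ)) s) :=
  continuous_iff_continuousAt.2 fun τ => (hasDerivAt_ddPowExp_neg p s τ).continuousAt

lemma hasDerivAt_thermalDD (p a b : ℕ) (τ : ℝ) :
    HasDerivAt (thermalDD E p a b) (-thermalDD E (p + 1) a b τ) τ :=
  hasDerivAt_ddPowExp_neg p _ τ

@[fun_prop] lemma continuous_thermalDD (p a b : ℕ) : Continuous (thermalDD E p a b) :=
  continuous_ddPowExp_neg p _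

lemma hasDerivAt_thermalDD_sub (p a b : ℕ) (T τ : ℝ) :
    HasDerivAt (fun τ => thermalDD E p a b (T - τ)) (thermalDD E (p + 1) a b (T - τ)) τ := by
  simpa using (hasDerivAt_thermalDD (E := E) p a b (T - τ)).comp_const_sub T τ

/-- The product of the divided differences of two adjacent intervals. -/
noncomputable def cutProd (E : ℕ → ℝ) (T : ℝ) (a b r : ℕ) (τ : ℝ) : ℂ :=
  thermalDD E 0 a r (T - τ) * thermalDD E 0 r b τ

lemma cutProd_left (T : ℝ) (a b : ℕ) (τ : ℝ) : cutProd E T a b a τ = 0 := by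
  simp [cutProd, thermalDD_of_le le_rfl]

lemma cutProd_right (T : ℝ) (a b : ℕ) (τ : ℝ) : cutProd E T a b b τ = 0 := by
  simp [cutProd, thermalDD_of_le le_rfl]

/-- The product rule raises `p` in one factor or the other. Peeling `E_r` from the right end of the
first and the left end of the second, the terms with `E_r` cancel and only neighbouring cuts remain.
The weights `1` and `r - a` are the ones used. -/
lemma hasDerivAt_weighted_split (X : ℕ → ℂ) (T : ℝ) {a b m : ℕ} (hm : m ≤ b) (τ : ℝ) :
    HasDerivAt (fun τ => ∑ r ∈ Finset.Ico a m,
        X r * (thermalDD E 0 a (r + 1) (T - τ) * thermalDD E 0 r b τ))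
      (∑ r ∈ Finset.Ico a m, X r * (cutProd E T a b r τ - cutProd E T a b (r + 1) τ)) τ := by
  refine HasDerivAt.fun_sum fun r hr => ?_
  rw [Finset.mem_Ico] at hr
  have h := ((hasDerivAt_thermalDD_sub (E := E) 0 a (r + 1) T τ).mul
    (hasDerivAt_thermalDD (E := E) 0 r b τ)).const_mul (X r)
  convert! h using 1
  rw [thermalDD_succ_left (by omega : r < b), thermalDD_succ_right hr.1, cutProd, cutProd]
  ring

lemma sum_Ico_telescope (G : ℕ → ℂ) {a m : ℕ} (h : a ≤ m) :
    ∑ r ∈ Finset.Ico a m, (1 : ℂ) * (G r - G (r + 1)) = G a - G m := by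
  induction m, h using Nat.le_induction with
  | base => simp
  | succ m h ih => rw [Finset.sum_Ico_succ_top h, ih]; ring

/-- The Leibniz rule `e^{-(u+v)[E_a,…]} = ∑ᵣ e^{-u[E_a,…,E_r]} e^{-v[E_r,…]}`. -/
lemma thermalDD_add {a b : ℕ} (hab : a < b) (u v : ℝ) :
    ∑ r ∈ Finset.Ico a b, thermalDD E 0 a (r + 1) u * thermalDD E 0 r b v =
      thermalDD E 0 a b (u + v) := by
  have hd := hasDerivAt_weighted_split (E := E) (fun _ => 1) (u + v) (le_refl b) (a := a)
  simp_rw [fun τ => sum_Ico_telescope (fun r => cutProd E (u + v) a b r τ) hab.le, cutProd_left,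
    cutProd_right, sub_zero, one_mul] at hd
  -- Both extreme cuts vanish, so the sum is constant in `τ`. It is compared at `τ = v` and at `τ =
  -- 0`, where only `r = b - 1` survives.
  have hc := is_const_of_deriv_eq_zero (fun τ => (hd τ).differentiableAt)
    (fun τ => (hd τ).deriv) v 0
  simp only [add_sub_cancel_right, sub_zero] at hc
  rw [hc, Finset.sum_eq_single_of_mem (b - 1) (by rw [Finset.mem_Ico]; omega)]
  · rw [thermalDD_at_zero, if_pos (by omega), mul_one, Nat.sub_add_cancel (by omega)]
  · intro r _ hr
    rw [thermalDD_at_zero, if_neg (by omega), mul_zero]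

/-- The Leibniz rule for `x * exp (-(u + v) * x)`. -/
lemma thermalDD_one_add {a b : ℕ} (hab : a < b) (u v : ℝ) :
    ∑ r ∈ Finset.Ico a b, thermalDD E 0 a (r + 1) u * thermalDD E 1 r b v =
      thermalDD E 1 a b (u + v) := by
  -- The previous rule is differentiated in `v` with `u` fixed.
  have h1 : HasDerivAt (fun v => ∑ r ∈ Finset.Ico a b,
      thermalDD E 0 a (r + 1) u * thermalDD E 0 r b v)
      (∑ r ∈ Finset.Ico a b, thermalDD E 0 a (r + 1) u * -thermalDD E 1 r b v) v :=
    HasDerivAt.fun_sum fun r _ => (hasDerivAt_thermalDD 0 r b v).const_mul _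
  simp_rw [thermalDD_add hab] at h1
  have h2 := (hasDerivAt_thermalDD (E := E) 0 a b (u + v)).comp_const_add u v
  have := h1.unique h2
  simpa [Finset.sum_neg_distrib] using this

/-- The integrand is the single cut at `i`, which is minus the derivative of the split sum truncated
at `i`. Of the boundary values only `r = a` at `τ = T` survives; at `τ = 0` none does, because `i <
n`. -/
lemma integral_thermalDD_mul_of_lt {a i n : ℕ} (hai : a < i) (hin : i < n) (T : ℝ) :
    ∫ τ in (0 : ℝ)..T, thermalDD E 0 a i (T - τ) * thermalDD E 0 i n τ = -thermalDD E 0 a n T := by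
  have hd := hasDerivAt_weighted_split (E := E) (fun _ => 1) T hin.le (a := a)
  simp_rw [fun τ => sum_Ico_telescope (fun r => cutProd E T a n r τ) hai.le, cutProd_left,
    zero_sub, one_mul] at hd
  have hc : Continuous fun τ => -cutProd E T a n i τ := by unfold cutProd; fun_prop
  have h := integral_eq_sub_of_hasDerivAt (fun τ _ => hd τ) (hc.intervalIntegrable 0 T)
  rw [integral_neg] at h
  change ∫ τ in (0 : ℝ)..T, cutProd E T a n i τ = _
  rw [← neg_eq_iff_eq_neg, h, sub_self, sub_zero, Finset.sum_eq_single_of_mem a (by simpa using hai),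
    Finset.sum_eq_zero (s := Finset.Ico a i), thermalDD_at_zero, if_pos rfl, one_mul, sub_zero]
  · intro r hr
    rw [Finset.mem_Ico] at hr
    rw [thermalDD_at_zero, if_neg (by omega), mul_zero]
  · intro r _ hr
    rw [thermalDD_at_zero, if_neg (by omega), zero_mul]

lemma integral_thermalDD_mul {a i b : ℕ} (hai : a ≤ i) (hib : i < b) (T : ℝ) :
    ∫ τ in (0 : ℝ)..T, thermalDD E 0 a (i + 1) (T - τ) * thermalDD E 0 i b τ =
      -ddPowExp 0 (-(T : ℂ)) ((E i : ℂ) ::ₘ icoSeg E a b) := by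
  -- Both factors contain `E i`. Inserting a second copy right after position `i` makes the two
  -- intervals disjoint.
  set F : ℕ → ℝ := fun k => if k ≤ i then E k else E (k - 1) with hF
  have h1 : icoSeg F a (i + 1) = icoSeg E a (i + 1) :=
    icoSeg_congr fun k _ hk => if_pos (by omega)
  have h2 : icoSeg F (i + 1) (b + 1) = icoSeg E i b := by
    rw [← icoSeg_shift F]
    refine icoSeg_congr fun k hk _ => ?_
    simp only [hF]; rw [if_neg (by omega), Nat.add_sub_cancel]
  have h3 : icoSeg F a (b + 1) = (E i : ℂ) ::ₘ icoSeg E a b := by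
    rw [icoSeg_add F (show a ≤ i + 1 by omega) (show i + 1 ≤ b + 1 by omega), h1, h2,
      icoSeg_right E hai, Multiset.cons_add, ← icoSeg_add E hai hib.le]
  have := integral_thermalDD_mul_of_lt (E := F) (show a < i + 1 by omega)
    (show i + 1 < b + 1 by omega) T
  simpa only [thermalDD, h1, h2, h3] using this

/-- Abel summation: linear weights turn differences of cuts into the plain sum of the interior cuts.
-/
lemma sum_Ico_mul_telescope (G : ℕ → ℂ) {a m : ℕ} (h : a < m) :
    ∑ r ∈ Finset.Ico a m, ((r : ℂ) - a) * (G r - G (r + 1)) =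
      ∑ r ∈ Finset.Ico (a + 1) m, G r - ((m : ℂ) - 1 - a) * G m := by
  induction m, h using Nat.le_induction with
  | base => simp
  | succ m h ih =>
    rw [Finset.sum_Ico_succ_top (by omega), ih, Finset.sum_Ico_succ_top (by omega)]
    push_cast; ring

/-- The recursion trades `E_r` for a factor `x` minus the product with `E_r` dropped on the right.
The first part adds up, by the Leibniz rule, to something independent of `τ`. -/
lemma sum_energy_mul_split {a b : ℕ} (hab : a < b) (T τ : ℝ) :
    ∑ r ∈ Finset.Ico a b, (E r : ℂ) * (thermalDD E 0 a (r + 1) (T - τ) * thermalDD E 0 r b τ) =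
      thermalDD E 1 a b T - ∑ r ∈ Finset.Ico (a + 1) b, cutProd E T a b r τ := by
  have h1 := thermalDD_one_add (E := E) hab (T - τ) τ
  rw [sub_add_cancel] at h1
  have h2 : ∑ r ∈ Finset.Ico a b, cutProd E T a b (r + 1) τ =
      ∑ r ∈ Finset.Ico (a + 1) b, cutProd E T a b r τ := by
    rw [Finset.sum_Ico_add' (fun r => cutProd E T a b r τ), Finset.sum_Ico_succ_top (by omega),
      cutProd_right, add_zero]
  rw [← h1, ← h2, ← Finset.sum_sub_distrib]
  refine Finset.sum_congr rfl fun r hr => ?_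
  rw [Finset.mem_Ico] at hr
  rw [thermalDD_succ_left hr.2, cutProd]; ring

/-- Integration by parts against `τ`: the sum of cuts is the derivative of the split sum with
weights `r - a`, and each remaining integral is a convolution. -/
lemma integral_mul_sum_cutProd {a b : ℕ} (hab : a < b) (T : ℝ) :
    ∫ τ in (0 : ℝ)..T, (τ : ℂ) * ∑ r ∈ Finset.Ico (a + 1) b, cutProd E T a b r τ =
      ∑ i ∈ Finset.Ico (a + 1) b, ((i : ℂ) - a) *
        ddPowExp 0 (-(T : ℂ)) ((E i : ℂ) ::ₘ icoSeg E a b) := by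
  have hd := hasDerivAt_weighted_split (E := E) (fun r => (r : ℂ) - a) T (le_refl b) (a := a)
  simp_rw [fun τ => sum_Ico_mul_telescope (fun r => cutProd E T a b r τ) hab, cutProd_right,
    mul_zero, sub_zero] at hd
  have hid : ∀ τ : ℝ, HasDerivAt (fun τ : ℝ => (τ : ℂ)) 1 τ := fun τ =>
    (hasDerivAt_id (τ : ℂ)).comp_ofReal
  have hc : Continuous fun τ => ∑ r ∈ Finset.Ico (a + 1) b, cutProd E T a b r τ := by
    unfold cutProd; fun_prop
  rw [integral_mul_deriv_eq_deriv_mul (fun τ _ => hid τ) (fun τ _ => hd τ)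
    (continuous_const.intervalIntegrable _ _) (hc.intervalIntegrable _ _)]
  -- At `τ = T` only `r = a` could survive, and there the weight vanishes.
  have h0 : ∑ r ∈ Finset.Ico a b, ((r : ℂ) - a) *
      (thermalDD E 0 a (r + 1) (T - T) * thermalDD E 0 r b T) = 0 := by
    refine Finset.sum_eq_zero fun r _ => ?_
    rw [sub_self, thermalDD_at_zero]
    split_ifs with h
    · rw [show r = a by omega]; simp
    · simp
  rw [h0, Complex.ofReal_zero, mul_zero, zero_mul, sub_zero, zero_sub]
  simp_rw [one_mul]
  rw [integral_finsetSum]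
  · simp_rw [integral_const_mul]
    rw [← Finset.sum_neg_distrib, ← Finset.sum_Ico_consecutive _ (Nat.le_succ a) hab,
      Nat.Ico_succ_singleton, Finset.sum_singleton, sub_self, zero_mul, neg_zero, zero_add]
    refine Finset.sum_congr rfl fun r hr => ?_
    rw [Finset.mem_Ico] at hr
    rw [integral_thermalDD_mul (by omega) hr.2, mul_neg, neg_neg]
  · intro r _
    exact Continuous.intervalIntegrable (by fun_prop) _ _

lemma integral_mul_sum_energy_split {a b : ℕ} (hab : a < b) (T : ℝ) :
    ∫ τ in (0 : ℝ)..T, (τ : ℂ) * ∑ r ∈ Finset.Ico a b,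
        (E r : ℂ) * (thermalDD E 0 a (r + 1) (T - τ) * thermalDD E 0 r b τ) =
      (T : ℂ) ^ 2 / 2 * thermalDD E 1 a b T -
      ∑ i ∈ Finset.Ico (a + 1) b, ((i : ℂ) - a) *
        ddPowExp 0 (-(T : ℂ)) ((E i : ℂ) ::ₘ icoSeg E a b) := by
  have hc : Continuous fun τ => ∑ r ∈ Finset.Ico (a + 1) b, cutProd E T a b r τ := by
    unfold cutProd; fun_prop
  simp_rw [sum_energy_mul_split hab, mul_sub]
  rw [integral_sub, integral_mul_sum_cutProd hab, integral_mul_const]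
  · congr 2
    rw [integral_ofReal, integral_id]; push_cast; ring
  · exact Continuous.intervalIntegrable (by fun_prop) _ _
  · exact (Complex.continuous_ofReal.mul hc).intervalIntegrable _ _

/-- The closed form of the imaginary time integral of one configuration. -/
lemma integral_mul_sum_energy (q : ℕ) (T : ℝ) :
    ∫ τ in (0 : ℝ)..T, (τ : ℂ) * ∑ r ∈ Finset.range (q + 1),
        (E r : ℂ) * (thermalDD E 0 0 (r + 1) (2 * T - τ) * thermalDD E 0 r (q + 1) τ) =
      ∑ r ∈ Finset.range (q + 1), thermalDD E 0 0 (r + 1) T *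
        ((T : ℂ) ^ 2 / 2 * thermalDD E 1 r (q + 1) T -
          ∑ i ∈ Finset.Ico (r + 1) (q + 1), ((i : ℂ) - r) *
            ddPowExp 0 (-(T : ℂ)) ((E i : ℂ) ::ₘ icoSeg E r (q + 1))) := by
  have h1 : ∀ τ : ℝ, (τ : ℂ) * ∑ r ∈ Finset.range (q + 1),
        (E r : ℂ) * (thermalDD E 0 0 (r + 1) (2 * T - τ) * thermalDD E 0 r (q + 1) τ) =
      ∑ s ∈ Finset.range (q + 1), thermalDD E 0 0 (s + 1) T * ((τ : ℂ) *
        ∑ r ∈ Finset.Ico s (q + 1),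
          (E r : ℂ) * (thermalDD E 0 s (r + 1) (T - τ) * thermalDD E 0 r (q + 1) τ)) := by
    intro τ
    have h2 : ∀ r ∈ Finset.range (q + 1),
        (E r : ℂ) * (thermalDD E 0 0 (r + 1) (2 * T - τ) * thermalDD E 0 r (q + 1) τ) =
        ∑ s ∈ Finset.Ico 0 (r + 1), thermalDD E 0 0 (s + 1) T *
          ((E r : ℂ) * (thermalDD E 0 s (r + 1) (T - τ) * thermalDD E 0 r (q + 1) τ)) := by
      intro r _
      -- Factoring out an evolution of duration `T` makes the remaining one vanish at the endpoint
      -- `τ = T`, as the integration by parts requires.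
      rw [show 2 * T - τ = T + (T - τ) by ring, ← thermalDD_add r.succ_pos, Finset.sum_mul,
        Finset.mul_sum]
      refine Finset.sum_congr rfl fun s _ => by ring
    rw [Finset.sum_congr rfl h2, Finset.sum_comm' (s' := fun s => Finset.Ico s (q + 1))
      (t' := Finset.range (q + 1)), Finset.mul_sum]
    · refine Finset.sum_congr rfl fun s _ => ?_
      rw [← Finset.mul_sum]; ring
    · intro r s
      simp only [Finset.mem_range, Finset.mem_Ico]; omega
  simp_rw [h1]
  rw [integral_finsetSum]
  · refine Finset.sum_congr rfl fun s hs => ?_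
    rw [integral_const_mul, integral_mul_sum_energy_split (Finset.mem_range.1 hs)]
  · intro s _
    exact Continuous.intervalIntegrable (by fun_prop) _ _

/-! ### Non-vanishing -/

/-- With the integrating factor `exp (a τ)`, the recursion leaves only the divided difference
without `a` in the derivative. Its sign is known by induction, and the function vanishes at `τ = 0`,
hence is strictly monotone from zero. This justifies dividing by the divided difference in the
weight. -/
lemma re_ddPowExp_neg_pos (s : Multiset ℝ) (a τ : ℝ) (hτ : 0 < τ) :
    0 < ((-1 : ℝ) ^ s.card * (ddPowExp 0 (-(τ : ℂ)) ((a ::ₘ s).map (fun x : ℝ => (x : ℂ)))).re) := by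
  induction s using Multiset.induction_on generalizing a τ with
  | empty =>
    simp only [Multiset.card_zero, pow_zero, one_mul, Multiset.cons_zero, Multiset.map_singleton,
      ddPowExp_zero_singleton]
    rw [show -(τ : ℂ) * a = ((-τ * a : ℝ) : ℂ) by push_cast; ring, Complex.exp_ofReal_re]
    exact Real.exp_pos _
  | cons b s ih =>
    set m : Multiset ℂ := (b ::ₘ s).map (fun x : ℝ => (x : ℂ)) with hm
    set g : ℝ → ℝ := fun τ => (-1 : ℝ) ^ (b ::ₘ s).card *
      (Real.exp (a * τ) * (ddPowExp 0 (-(τ : ℂ)) ((a : ℂ) ::ₘ m)).re) with hg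
    have hd : ∀ τ : ℝ, HasDerivAt g (Real.exp (a * τ) *
        ((-1 : ℝ) ^ s.card * (ddPowExp 0 (-(τ : ℂ)) m).re)) τ := by
      intro τ
      have h1 : HasDerivAt (fun τ : ℝ => (ddPowExp 0 (-(τ : ℂ)) ((a : ℂ) ::ₘ m)).re) _ τ :=
        Complex.reCLM.hasFDerivAt.comp_hasDerivAt τ (hasDerivAt_ddPowExp_neg 0 ((a : ℂ) ::ₘ m) τ)
      have h2 : HasDerivAt (fun τ : ℝ => Real.exp (a * τ)) (Real.exp (a * τ) * a) τ := by
        simpa using ((hasDerivAt_id τ).const_mul a).exp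
      have h3 := (h2.mul h1).const_mul ((-1 : ℝ) ^ (b ::ₘ s).card)
      convert! h3 using 1
      rw [ddPowExp_succ_cons, Multiset.card_cons, pow_succ]
      simp only [Complex.reCLM_apply, Complex.neg_re, Complex.add_re, Complex.re_ofReal_mul]
      ring
    have hmono : StrictMonoOn g (Set.Ici 0) := by
      refine strictMonoOn_of_deriv_pos (convex_Ici 0)
        (fun τ _ => (hd τ).continuousAt.continuousWithinAt) fun τ hτ => ?_
      rw [interior_Ici] at hτ
      rw [(hd τ).deriv]
      exact mul_pos (Real.exp_pos _) (ih b τ hτ)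
    have h0 : g 0 = 0 := by
      simp [hg, ddPowExp_zero_left, hm]
    have h1 := hmono (Set.mem_Ici.2 le_rfl) (Set.mem_Ici.2 hτ.le) hτ
    rw [h0, hg] at h1
    have h2 : g τ = Real.exp (a * τ) * ((-1 : ℝ) ^ (b ::ₘ s).card *
      (ddPowExp 0 (-(τ : ℂ)) ((a ::ₘ b ::ₘ s).map (fun x : ℝ => (x : ℂ)))).re) := by
      rw [Multiset.map_cons _ a]; simp only [hg]; ring
    change 0 < g τ at h1
    rw [h2] at h1
    exact pos_of_mul_pos_right h1 (Real.exp_pos _).le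

lemma ddExp_seg_ne_zero (q : ℕ) {β : ℝ} (hβ : 0 < β) : ddExp (-β) (seg E 0 q) ≠ 0 := by
  have h : seg E 0 q = (E 0 ::ₘ (Finset.Ico 1 (q + 1)).val.map E).map (fun x : ℝ => (x : ℂ)) := by
    rw [seg_eq_icoSeg, icoSeg_left E q.succ_pos, Multiset.map_cons, Multiset.map_map]; rfl
  intro h0
  have := re_ddPowExp_neg_pos ((Finset.Ico 1 (q + 1)).val.map E) (E 0) β hβ
  rw [← h, ← ddExp_eq, h0] at this
  simp at this

end PMRQMC

namespace PMRQMC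

open Filter Topology

/-! ### Sums over lists -/

lemma hasSum_list {α : Type*} [Fintype α] {f : List α → ℂ} {s : α → ℂ}
    (h : ∀ j, HasSum (fun l => f (j :: l)) (s j)) : HasSum f (f [] + ∑ j, s j) := by
  classical
  have h0 : HasSum (fun l : List α => if l = [] then f l else 0) (f []) := by
    have := hasSum_ite_eq ([] : List α) (f [])
    refine this.congr_fun fun l => ?_
    split_ifs with hl <;> simp [hl]
  have h1 : ∀ j, HasSum (fun l : List α => if l.head? = some j then f l else 0) (s j) := by
    intro j
    have hinj : Function.Injective (fun l : List α => j :: l) := List.cons_injective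
    refine (hinj.hasSum_iff ?_).1 (by simpa [Function.comp_def] using h j)
    intro l hl
    rw [if_neg]
    intro hj
    cases l with
    | nil => simp at hj
    | cons a l =>
      simp only [List.head?_cons, Option.some.injEq] at hj
      exact hl ⟨l, by rw [hj]⟩
  refine (h0.add (hasSum_sum (s := Finset.univ) fun j _ => h1 j)).congr_fun fun l => ?_
  cases l <;> simp

/-- There are `M ^ n` lists of length `n`, so this is a geometric series. -/
lemma summable_pow_length (M : ℕ) {u : ℝ} (hu : 0 ≤ u) (h : M * u < 1) :
    Summable (fun l : List (Fin M) => u ^ l.length) := by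
  rw [← (Equiv.sigmaFiberEquiv (List.length (α := Fin M))).summable_iff]
  have hfib : ∀ n : ℕ, HasSum (fun l : {l : List (Fin M) // l.length = n} => u ^ n)
      ((M * u) ^ n) := by
    intro n
    let _ : Fintype {l : List (Fin M) // l.length = n} :=
      inferInstanceAs (Fintype (List.Vector (Fin M) n))
    have hc : Fintype.card {l : List (Fin M) // l.length = n} = M ^ n :=
      (card_vector (α := Fin M) n).trans (by simp)
    convert! hasSum_fintype (fun l : {l : List (Fin M) // l.length = n} => u ^ n) using 1
    rw [Finset.sum_const, Finset.card_univ, hc, nsmul_eq_mul, mul_pow]; push_cast; ring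
  have heq : ∀ x : Σ n : ℕ, {l : List (Fin M) // l.length = n},
      ((fun l : List (Fin M) => u ^ l.length) ∘ (Equiv.sigmaFiberEquiv List.length)) x = u ^ x.1 := by
    rintro ⟨n, l, hl⟩; simp [Equiv.sigmaFiberEquiv, hl]
  refine Summable.congr ?_ fun x => (heq x).symm
  refine (summable_sigma_of_nonneg fun x => by positivity).2 ⟨fun n => (hfib n).summable, ?_⟩
  simp_rw [fun n => (hfib n).tsum_eq]
  exact summable_geometric_of_lt_one (by positivity) h

/-- A pair of lists is the same as its concatenation together with the position of the cut. -/
lemma hasSum_list_split {α : Type*} {F : List α × List α → ℂ} {S : ℂ} (h : HasSum F S) :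
    HasSum (fun l : List α => ∑ r ∈ Finset.range (l.length + 1), F (l.take r, l.drop r)) S := by
  set G : List α × ℕ → ℂ := fun x =>
    if x.2 ≤ x.1.length then F (x.1.take x.2, x.1.drop x.2) else 0 with hG
  set i : List α × List α → List α × ℕ := fun x => (x.1 ++ x.2, x.1.length) with hi
  have hinj : Function.Injective i := by
    rintro ⟨a, b⟩ ⟨c, d⟩ h
    simp only [hi, Prod.mk.injEq] at h
    obtain ⟨h1, h2⟩ := List.append_inj h.1 h.2
    rw [h1, h2]
  have hGS : HasSum G S := by
    have hGi : G ∘ i = F := by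
      funext x
      simp [hG, hi]
    rw [← hGi] at h
    refine (Function.Injective.hasSum_iff (f := G) (a := S) hinj ?_).1 h
    rintro ⟨l, r⟩ hx
    simp only [hG]
    rw [if_neg]
    intro hr
    refine hx ⟨(l.take r, l.drop r), ?_⟩
    simp only [hi, List.take_append_drop, List.length_take, min_eq_left hr]
  refine hGS.prod_fiberwise fun l => ?_
  have : HasSum (fun r => G (l, r)) (∑ r ∈ Finset.range (l.length + 1), G (l, r)) :=
    hasSum_sum_of_ne_finset_zero (fun r hr => by
      simp only [hG]
      rw [if_neg]
      simpa [Nat.lt_succ_iff] using hr)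
  convert! this using 1
  refine Finset.sum_congr rfl fun r hr => ?_
  simp only [hG]
  rw [if_pos]
  simpa [Nat.lt_succ_iff] using hr

namespace PMR

variable {ι : Type*} {M : ℕ} (H : PMR ι M)

/-! ### Paths -/

@[simp] lemma permProd_nil : H.permProd [] = 1 := by simp [permProd]

lemma permProd_cons (j : Fin M) (l : List (Fin M)) (z : ι) :
    H.permProd (j :: l) z = H.permProd l (H.P j z) := by
  simp [permProd]

lemma permProd_append (l₁ l₂ : List (Fin M)) (z : ι) :
    H.permProd (l₁ ++ l₂) z = H.permProd l₂ (H.permProd l₁ z) := by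
  simp [permProd]

/-- The hopping strength of the path that starts at `z` and follows `l`. -/
def pathHop : ι → List (Fin M) → ℂ
  | _, [] => 1
  | z, j :: l => H.D j (H.P j z) * pathHop (H.P j z) l

/-- The energies along the path that starts at `z` and follows `l`. -/
def pathEnergy (z : ι) (l : List (Fin M)) (k : ℕ) : ℝ := H.D₀ (H.permProd (l.take k) z)

/-- All the energies along a path. -/
def pathSeg (z : ι) (l : List (Fin M)) : Multiset ℂ := icoSeg (H.pathEnergy z l) 0 (l.length + 1)

lemma pathHop_append (z : ι) (l₁ l₂ : List (Fin M)) :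
    H.pathHop z (l₁ ++ l₂) = H.pathHop z l₁ * H.pathHop (H.permProd l₁ z) l₂ := by
  induction l₁ generalizing z with
  | nil => simp [pathHop]
  | cons j l ih => simp only [List.cons_append, pathHop, ih, permProd_cons, mul_assoc]

lemma pathSeg_nil (z : ι) : H.pathSeg z [] = {(H.D₀ z : ℂ)} := by
  simp [pathSeg, icoSeg, pathEnergy]

lemma pathEnergy_append_of_le (z : ι) (l₁ l₂ : List (Fin M)) {k : ℕ} (hk : k ≤ l₁.length) :
    H.pathEnergy z (l₁ ++ l₂) k = H.pathEnergy z l₁ k := by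
  rw [pathEnergy, pathEnergy, List.take_append_of_le_length hk]

lemma pathEnergy_append_add (z : ι) (l₁ l₂ : List (Fin M)) (k : ℕ) :
    H.pathEnergy z (l₁ ++ l₂) (k + l₁.length) = H.pathEnergy (H.permProd l₁ z) l₂ k := by
  rw [pathEnergy, pathEnergy, add_comm, List.take_length_add_append, permProd_append]

lemma icoSeg_append_left (z : ι) (l₁ l₂ : List (Fin M)) :
    icoSeg (H.pathEnergy z (l₁ ++ l₂)) 0 (l₁.length + 1) = H.pathSeg z l₁ :=
  icoSeg_congr fun _ _ hk => H.pathEnergy_append_of_le z l₁ l₂ (by omega)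

/-- The state where the two paths meet belongs to both, so this segment starts at `l₁.length`, the
last position of the first one. -/
lemma icoSeg_append_right (z : ι) (l₁ l₂ : List (Fin M)) :
    icoSeg (H.pathEnergy z (l₁ ++ l₂)) l₁.length ((l₁ ++ l₂).length + 1) =
      H.pathSeg (H.permProd l₁ z) l₂ := by
  have h := icoSeg_shift (H.pathEnergy z (l₁ ++ l₂)) 0 (l₂.length + 1) l₁.length
  rw [zero_add, show l₂.length + 1 + l₁.length = (l₁ ++ l₂).length + 1 by
    rw [List.length_append]; omega] at h
  rw [← h, pathSeg]
  exact icoSeg_congr fun k _ _ => H.pathEnergy_append_add z l₁ l₂ k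

lemma pathSeg_cons (z : ι) (j : Fin M) (l : List (Fin M)) :
    H.pathSeg z (j :: l) = (H.D₀ z : ℂ) ::ₘ H.pathSeg (H.P j z) l := by
  have h := H.icoSeg_append_right z [j] l
  rw [List.singleton_append, List.length_singleton] at h
  rw [pathSeg, icoSeg_left _ (Nat.succ_pos _), zero_add, h, permProd_cons]
  simp [pathEnergy]

lemma card_pathSeg (z : ι) (l : List (Fin M)) : (H.pathSeg z l).card = l.length + 1 := by
  simp [pathSeg]

lemma pathSeg_eq_cons (z : ι) (l : List (Fin M)) :
    ∃ s, H.pathSeg z l = (H.D₀ z : ℂ) ::ₘ s ∧ s.card = l.length := by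
  cases l with
  | nil => exact ⟨0, by simp [pathSeg_nil], rfl⟩
  | cons j l => exact ⟨_, H.pathSeg_cons z j l, by rw [card_pathSeg]; rfl⟩

/-! ### Powers of the Hamiltonian as sums over paths -/

section Sums

variable [Fintype ι] [DecidableEq ι]

/-- Right multiplication adds a step at the start of a path; the diagonal acts after the
permutation, hence is evaluated at the state reached. -/
lemma mul_mat_apply (A : Matrix ι ι ℂ) (z' z : ι) :
    (A * H.mat) z' z = A z' z * H.D₀ z + ∑ j, A z' (H.P j z) * H.D j (H.P j z) := by
  rw [mat, mul_add, Matrix.add_apply, diagMat, Matrix.mul_diagonal, Finset.mul_sum,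
    Matrix.sum_apply]
  congr 1
  refine Finset.sum_congr rfl fun j _ => ?_
  rw [Matrix.mul_apply, Finset.sum_eq_single (H.P j z)]
  · simp [Matrix.diagonal_mul, permMat]
  · intro x _ hx
    simp [Matrix.diagonal_mul, permMat, hx.symm]
  · simp

/-- Induction through `H ^ (k + 1) = H ^ k * H`, matching the first step of the path with the
recursion at the first node. For `k = 0` only the empty path has a nonzero moment. -/
lemma hasSum_path_moment (k : ℕ) (z z' : ι) :
    HasSum (fun l => if H.permProd l z = z' then H.pathHop z l * ddMoment k (H.pathSeg z l) else 0)
      ((H.mat ^ k) z' z) := by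
  induction k generalizing z with
  | zero =>
    have : HasSum (fun l : List (Fin M) => if l = [] then (H.mat ^ 0) z' z else 0)
        ((H.mat ^ 0) z' z) := hasSum_ite_eq [] _
    refine this.congr_fun fun l => ?_
    rw [ddMoment_zero, card_pathSeg]
    cases l with
    | nil => simp [pathHop, Matrix.one_apply, eq_comm]
    | cons j l => simp
  | succ k ih =>
    set f : ι → List (Fin M) → ℂ := fun z l =>
      if H.permProd l z = z' then H.pathHop z l * ddMoment k (H.pathSeg z l) else 0 with hf
    -- The first term stays at `z` and keeps the path; the second makes the first hop and continues
    -- along the tail.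
    set g : List (Fin M) → ℂ := fun l => (H.D₀ z : ℂ) * f z l +
      (if hl : l = [] then 0 else
        H.D (l.head hl) (H.P (l.head hl) z) * f (H.P (l.head hl) z) l.tail) with hg
    have hcons : ∀ j : Fin M, HasSum (fun l => f z (j :: l)) (∑' l, f z (j :: l)) := fun j =>
      ((ih z).summable.comp_injective (i := fun l => j :: l) List.cons_injective).hasSum
    have hz : f z [] + ∑ j, ∑' l, f z (j :: l) = (H.mat ^ k) z' z := (hasSum_list hcons).unique (ih z)
    have hgj : ∀ j : Fin M, HasSum (fun l => g (j :: l))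
        ((H.D₀ z : ℂ) * (∑' l, f z (j :: l)) +
          H.D j (H.P j z) * (H.mat ^ k) z' (H.P j z)) := by
      intro j
      simp only [hg, List.cons_ne_nil, dite_false, List.head_cons, List.tail_cons]
      exact ((hcons j).mul_left _).add ((ih (H.P j z)).mul_left _)
    have hlist := hasSum_list hgj
    convert! hlist using 1
    · funext l
      cases l with
      | nil =>
        have := ddMoment_succ_cons k (H.D₀ z) 0
        simp only [Multiset.cons_zero, ddMoment_zero_right, add_zero] at this
        simp only [hg, hf, pathSeg_nil, this, pathHop, one_mul, mul_ite, mul_zero, dite_true,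
          add_zero]
      | cons j l =>
        simp only [hg, hf, List.cons_ne_nil, dite_false, List.head_cons, List.tail_cons,
          permProd_cons, pathSeg_cons, ddMoment_succ_cons, pathHop]
        by_cases hp : H.permProd l (H.P j z) = z'
        · simp only [hp, if_true]; ring
        · simp only [hp, if_false, mul_zero, add_zero]
    · rw [pow_succ, mul_mat_apply, Finset.sum_add_distrib, ← Finset.mul_sum, ← add_assoc, ← hz]
      congr 1
      · simp only [hg, dite_true]; ring
      · exact Finset.sum_congr rfl fun j _ => mul_comm _ _

end Sums

/-! ### The exponential of the Hamiltonian -/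

/-- Here `u` will be the effective weight per hop once the factor `μ` is absorbed by the divided
difference. The extra `2` leaves room for the number of cuts of a path. -/
lemma exists_path_bound [Fintype ι] : ∃ Λ μ u : ℝ, 0 ≤ Λ ∧ 0 < μ ∧ 0 ≤ u ∧ M * (2 * u) < 1 ∧
    (∀ z, |H.D₀ z| ≤ Λ) ∧ ∀ z l, ‖H.pathHop z l‖ ≤ (u * μ) ^ l.length := by
  set h : ℝ := ∑ j, ∑ z, ‖H.D j z‖ with hh
  have hh0 : 0 ≤ h := Finset.sum_nonneg fun j _ => Finset.sum_nonneg fun z _ => norm_nonneg _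
  have hμ : 0 < 4 * (M * h + 1) := by positivity
  -- The choice `u = h / μ` gives `u * μ = h`, which bounds every hop, and `μ = 4 (M h + 1)` makes
  -- `2 M u < 1`.
  refine ⟨∑ z, |H.D₀ z|, 4 * (M * h + 1), h / (4 * (M * h + 1)),
    Finset.sum_nonneg fun z _ => abs_nonneg _, hμ, by positivity, ?_, fun z => ?_, fun z l => ?_⟩
  · rw [← mul_assoc, ← mul_div_assoc, div_lt_one hμ]
    nlinarith [mul_nonneg (Nat.cast_nonneg (α := ℝ) M) hh0]
  · exact Finset.single_le_sum (f := fun z => |H.D₀ z|) (fun z _ => abs_nonneg _)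
      (Finset.mem_univ z)
  · rw [div_mul_cancel₀ _ hμ.ne']
    induction l generalizing z with
    | nil => simp [pathHop]
    | cons j l ih =>
      rw [pathHop, norm_mul, List.length_cons, pow_succ, mul_comm]
      refine mul_le_mul (ih _) ?_ (norm_nonneg _) (by positivity)
      calc ‖H.D j (H.P j z)‖ ≤ ∑ z, ‖H.D j z‖ :=
            Finset.single_le_sum (f := fun z => ‖H.D j z‖) (fun z _ => norm_nonneg _)
              (Finset.mem_univ _)
        _ ≤ h := Finset.single_le_sum (f := fun j => ∑ z, ‖H.D j z‖)
            (fun j _ => Finset.sum_nonneg fun z _ => norm_nonneg _) (Finset.mem_univ j)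

variable {H}

lemma norm_le_of_mem_pathSeg {Λ : ℝ} (hΛ : ∀ z, |H.D₀ z| ≤ Λ) (z : ι) (l : List (Fin M)) :
    ∀ y ∈ H.pathSeg z l, ‖y‖ ≤ Λ := by
  intro y hy
  simp only [pathSeg, icoSeg, Multiset.mem_map] at hy
  obtain ⟨k, -, rfl⟩ := hy
  rw [Complex.norm_real]
  exact hΛ _

lemma norm_pathHop_mul_moment_le {Λ μ u : ℝ} (hμ : 0 < μ) (hu : 0 ≤ u) (hΛ : ∀ z, |H.D₀ z| ≤ Λ)
    (hhop : ∀ z l, ‖H.pathHop z l‖ ≤ (u * μ) ^ l.length) (k : ℕ) (z : ι) (l : List (Fin M)) :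
    ‖H.pathHop z l * ddMoment k (H.pathSeg z l)‖ ≤ u ^ l.length * (Λ + μ) ^ k := by
  obtain ⟨s, hs, hc⟩ := H.pathSeg_eq_cons z l
  have h1 := norm_ddMoment_cons_le hμ.le k _ s fun y hy =>
    norm_le_of_mem_pathSeg hΛ z l y (hs ▸ hy)
  rw [← hs, hc] at h1
  rw [norm_mul]
  calc _ ≤ (u * μ) ^ l.length * ‖ddMoment k (H.pathSeg z l)‖ :=
        mul_le_mul_of_nonneg_right (hhop z l) (norm_nonneg _)
    _ = u ^ l.length * (‖ddMoment k (H.pathSeg z l)‖ * μ ^ l.length) := by rw [mul_pow]; ring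
    _ ≤ _ := mul_le_mul_of_nonneg_left h1 (by positivity)

lemma norm_pathHop_mul_exp_le {Λ μ u : ℝ} (hμ : 0 < μ) (hu : 0 ≤ u) (hΛ : ∀ z, |H.D₀ z| ≤ Λ)
    (hhop : ∀ z l, ‖H.pathHop z l‖ ≤ (u * μ) ^ l.length) (p : ℕ) (t : ℂ) (z : ι)
    (l : List (Fin M)) :
    ‖H.pathHop z l * ddPowExp p t (H.pathSeg z l)‖ ≤
      u ^ l.length * ((Λ + μ) ^ p * Real.exp (‖t‖ * (Λ + μ))) := by
  obtain ⟨s, hs, hc⟩ := H.pathSeg_eq_cons z l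
  have h1 := norm_ddPowExp_cons_le hμ.le p t _ s fun y hy =>
    norm_le_of_mem_pathSeg hΛ z l y (hs ▸ hy)
  rw [← hs, hc] at h1
  rw [norm_mul]
  calc _ ≤ (u * μ) ^ l.length * ‖ddPowExp p t (H.pathSeg z l)‖ :=
        mul_le_mul_of_nonneg_right (hhop z l) (norm_nonneg _)
    _ = u ^ l.length * (‖ddPowExp p t (H.pathSeg z l)‖ * μ ^ l.length) := by rw [mul_pow]; ring
    _ ≤ _ := mul_le_mul_of_nonneg_left h1 (by positivity)

variable (H) [Fintype ι] [DecidableEq ι]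

/-- Fubini for the absolutely summable family indexed by paths and powers. The value `S` is left
unnamed because the first series is also what shows, entrywise, that the matrix exponential series
converges. -/
lemma exists_hasSum_path_exp (p : ℕ) (t : ℂ) (z z' : ι) :
    ∃ S : ℂ, HasSum (fun k : ℕ => t ^ k / (k.factorial : ℂ) * (H.mat ^ (k + p)) z' z) S ∧
      HasSum (fun l => if H.permProd l z = z' then
        H.pathHop z l * ddPowExp p t (H.pathSeg z l) else 0) S := by
  obtain ⟨Λ, μ, u, hΛ0, hμ, hu, hMu, hΛ, hhop⟩ := H.exists_path_bound
  set F : List (Fin M) × ℕ → ℂ := fun x => if H.permProd x.1 z = z' then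
    (x.2.factorial : ℂ)⁻¹ * t ^ x.2 * (H.pathHop z x.1 * ddMoment (x.2 + p) (H.pathSeg z x.1)) else 0
    with hF
  have hb : Summable fun x : List (Fin M) × ℕ =>
      u ^ x.1.length * (‖t‖ ^ x.2 / (x.2.factorial : ℝ) * (Λ + μ) ^ (x.2 + p)) :=
    (summable_pow_length M hu (by nlinarith [mul_nonneg (Nat.cast_nonneg (α := ℝ) M) hu])
      ).mul_of_nonneg
      (summable_ddPowExp_bound ‖t‖ (Λ + μ) p) (fun l => by positivity) (fun k => by positivity)
  have hs : Summable F := by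
    refine Summable.of_norm_bounded hb fun x => ?_
    simp only [hF]
    split_ifs
    · rw [norm_mul, norm_mul, norm_inv, norm_pow, Complex.norm_natCast]
      have := norm_pathHop_mul_moment_le hμ hu hΛ hhop (x.2 + p) z x.1
      calc _ ≤ (x.2.factorial : ℝ)⁻¹ * ‖t‖ ^ x.2 * (u ^ x.1.length * (Λ + μ) ^ (x.2 + p)) := by
            gcongr
        _ = _ := by ring
    · rw [norm_zero]; positivity
  refine ⟨∑' x, F x, ?_, ?_⟩
  · have hsw : HasSum (F ∘ Prod.swap) (∑' x, F x) :=
      (Equiv.prodComm ℕ (List (Fin M))).hasSum_iff.2 hs.hasSum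
    refine hsw.prod_fiberwise fun k => ?_
    have := (H.hasSum_path_moment (k + p) z z').mul_left (t ^ k / (k.factorial : ℂ))
    refine this.congr_fun fun l => ?_
    simp only [hF, Function.comp, Prod.swap]
    split_ifs <;> ring
  · refine hs.hasSum.prod_fiberwise fun l => ?_
    simp only [hF]
    split_ifs
    · refine ((hasSum_ddPowExp p t (H.pathSeg z l)).mul_left (H.pathHop z l)).congr_fun fun k => ?_
      ring
    · exact hasSum_zero

lemma hasSum_mat_pow_mul_exp (p : ℕ) (t : ℂ) :
    HasSum (fun k : ℕ => (t ^ k / (k.factorial : ℂ)) • H.mat ^ (k + p))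
      (H.mat ^ p * NormedSpace.exp (t • H.mat)) := by
  have h0 : HasSum (fun k : ℕ => (t ^ k / (k.factorial : ℂ)) • H.mat ^ k)
      (NormedSpace.exp (t • H.mat)) := by
    have hs : Summable (fun k : ℕ => (t ^ k / (k.factorial : ℂ)) • H.mat ^ k) := by
      refine Pi.summable.2 fun z' => Pi.summable.2 fun z => ?_
      obtain ⟨S, hS, -⟩ := H.exists_hasSum_path_exp 0 t z z'
      exact hS.summable
    rw [NormedSpace.exp_eq_tsum ℂ]
    convert! hs.hasSum using 2
    funext k
    rw [smul_pow, smul_smul, div_eq_inv_mul]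
  refine (h0.mul_left (H.mat ^ p)).congr_fun fun k => ?_
  rw [Matrix.mul_smul, ← pow_add, add_comm]

lemma hasSum_path_exp (p : ℕ) (t : ℂ) (z z' : ι) :
    HasSum (fun l => if H.permProd l z = z' then
        H.pathHop z l * ddPowExp p t (H.pathSeg z l) else 0)
      ((H.mat ^ p * NormedSpace.exp (t • H.mat)) z' z) := by
  obtain ⟨S, hS, h⟩ := H.exists_hasSum_path_exp p t z z'
  have h1 := Pi.hasSum.1 (Pi.hasSum.1 (H.hasSum_mat_pow_mul_exp p t) z') z
  rwa [h1.unique hS]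

end PMR

end PMRQMC

namespace PMRQMC

open Filter Topology

namespace PMR

variable {ι : Type*} {M : ℕ} {H : PMR ι M}

/-! ### Two consecutive imaginary time evolutions -/

/-- The contribution of a path to `e^{-vH} D₀ e^{-uH}`. -/
noncomputable def pathSplit (H : PMR ι M) (z : ι) (l : List (Fin M)) (u v : ℝ) : ℂ :=
  ∑ r ∈ Finset.range (l.length + 1), (H.pathEnergy z l r : ℂ) *
    (thermalDD (H.pathEnergy z l) 0 0 (r + 1) u *
      thermalDD (H.pathEnergy z l) 0 r (l.length + 1) v)

/-- The contribution of a pair of consecutive paths to `e^{-vH} D₀ e^{-uH}`. -/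
noncomputable def pairTerm (H : PMR ι M) (z : ι) (u v : ℝ)
    (x : List (Fin M) × List (Fin M)) : ℂ :=
  H.pathHop z x.1 * ddPowExp 0 (-(u : ℂ)) (H.pathSeg z x.1) *
    ((H.D₀ (H.permProd x.1 z) : ℂ) * (H.pathHop (H.permProd x.1 z) x.2 *
      ddPowExp 0 (-(v : ℂ)) (H.pathSeg (H.permProd x.1 z) x.2)))

lemma pathHop_mul_split_term (z : ι) (l₁ l₂ : List (Fin M)) (u v : ℝ) :
    H.pathHop z (l₁ ++ l₂) * ((H.pathEnergy z (l₁ ++ l₂) l₁.length : ℂ) *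
      (thermalDD (H.pathEnergy z (l₁ ++ l₂)) 0 0 (l₁.length + 1) u *
        thermalDD (H.pathEnergy z (l₁ ++ l₂)) 0 l₁.length ((l₁ ++ l₂).length + 1) v)) =
      H.pairTerm z u v (l₁, l₂) := by
  rw [thermalDD, thermalDD, icoSeg_append_left, icoSeg_append_right, pathHop_append,
    pathEnergy_append_of_le _ _ _ _ le_rfl, pairTerm, pathEnergy, List.take_length]
  ring

lemma pathHop_mul_pathSplit (z : ι) (l : List (Fin M)) (u v : ℝ) :
    H.pathHop z l * H.pathSplit z l u v =
      ∑ r ∈ Finset.range (l.length + 1), H.pairTerm z u v (l.take r, l.drop r) := by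
  rw [pathSplit, Finset.mul_sum]
  refine Finset.sum_congr rfl fun r hr => ?_
  have hr' : (l.take r).length = r := by
    rw [List.length_take, min_eq_left]
    simpa [Nat.lt_succ_iff] using hr
  have := H.pathHop_mul_split_term z (l.take r) (l.drop r) u v
  rwa [List.take_append_drop, hr'] at this

lemma norm_pairTerm_le {Λ μ w : ℝ} (hμ : 0 < μ) (hw : 0 ≤ w) (hΛ : ∀ z, |H.D₀ z| ≤ Λ)
    (hhop : ∀ z l, ‖H.pathHop z l‖ ≤ (w * μ) ^ l.length) (z : ι) (u v : ℝ)
    (x : List (Fin M) × List (Fin M)) :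
    ‖H.pairTerm z u v x‖ ≤ w ^ x.1.length * Real.exp (|u| * (Λ + μ)) *
      (Λ * (w ^ x.2.length * Real.exp (|v| * (Λ + μ)))) := by
  have hΛ0 : 0 ≤ Λ := (abs_nonneg _).trans (hΛ z)
  have h1 := norm_pathHop_mul_exp_le hμ hw hΛ hhop 0 (-(u : ℂ)) z x.1
  have h2 := norm_pathHop_mul_exp_le hμ hw hΛ hhop 0 (-(v : ℂ)) (H.permProd x.1 z) x.2
  rw [pow_zero, one_mul, norm_neg, Complex.norm_real, Real.norm_eq_abs] at h1 h2
  rw [pairTerm, norm_mul, norm_mul (Complex.ofReal _), Complex.norm_real]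
  gcongr
  exact hΛ _

lemma norm_pathHop_mul_pathSplit_le {Λ μ w : ℝ} (hμ : 0 < μ) (hw : 0 ≤ w)
    (hΛ : ∀ z, |H.D₀ z| ≤ Λ) (hhop : ∀ z l, ‖H.pathHop z l‖ ≤ (w * μ) ^ l.length) (z : ι)
    (l : List (Fin M)) (u v : ℝ) :
    ‖H.pathHop z l * H.pathSplit z l u v‖ ≤ (2 * w) ^ l.length *
      (Λ * (Real.exp (|u| * (Λ + μ)) * Real.exp (|v| * (Λ + μ)))) := by
  have hΛ0 : 0 ≤ Λ := (abs_nonneg _).trans (hΛ z)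
  set K := Λ * (Real.exp (|u| * (Λ + μ)) * Real.exp (|v| * (Λ + μ))) with hK
  have hK0 : 0 ≤ K := by positivity
  rw [pathHop_mul_pathSplit]
  calc _ ≤ ∑ r ∈ Finset.range (l.length + 1), w ^ l.length * K := by
        refine norm_sum_le_of_le _ fun r hr => ?_
        refine (norm_pairTerm_le hμ hw hΛ hhop z u v _).trans (le_of_eq ?_)
        have hr' : r ≤ l.length := by simpa [Nat.lt_succ_iff] using hr
        have : w ^ l.length = w ^ (l.take r).length * w ^ (l.drop r).length := by
          rw [← pow_add, ← List.length_append, List.take_append_drop]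
        rw [this]; simp only [hK]; ring
    _ = ((l.length + 1 : ℕ) : ℝ) * (w ^ l.length * K) := by simp
    -- The `length + 1` cuts are absorbed into `2 ^ length`, keeping the bound geometric.
    _ ≤ (2 : ℝ) ^ l.length * (w ^ l.length * K) := by
        gcongr
        exact_mod_cast Nat.lt_two_pow_self
    _ = _ := by rw [mul_pow]; ring

lemma continuous_pathSplit (z : ι) (l : List (Fin M)) (β : ℝ) :
    Continuous fun τ => H.pathSplit z l (β - τ) τ := by
  unfold pathSplit; fun_prop

variable (H) [Fintype ι] [DecidableEq ι]

/-- Pairs of paths are summed in two ways: iterated, they give the matrix product; grouped by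
concatenation, they give the sum over cuts. The endpoint condition depends only on the
concatenation. -/
lemma hasSum_path_split (u v : ℝ) (z z' : ι) :
    HasSum (fun l => if H.permProd l z = z' then H.pathHop z l * H.pathSplit z l u v else 0)
      ((NormedSpace.exp (-(v : ℂ) • H.mat) * H.diagMat * NormedSpace.exp (-(u : ℂ) • H.mat))
        z' z) := by
  obtain ⟨Λ, μ, w, hΛ0, hμ, hw, hMw, hΛ, hhop⟩ := H.exists_path_bound
  have hsw := summable_pow_length M hw (by nlinarith [mul_nonneg (Nat.cast_nonneg (α := ℝ) M) hw])
  set F : List (Fin M) × List (Fin M) → ℂ := fun x =>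
    if H.permProd x.2 (H.permProd x.1 z) = z' then H.pairTerm z u v x else 0 with hF
  have hs : Summable F := by
    refine Summable.of_norm_bounded ((hsw.mul_right (Real.exp (|u| * (Λ + μ)))).mul_of_nonneg
      ((hsw.mul_right (Real.exp (|v| * (Λ + μ)))).mul_left Λ) (fun l => by positivity)
      (fun l => by positivity)) fun x => ?_
    simp only [hF]
    split_ifs
    · exact norm_pairTerm_le hμ hw hΛ hhop z u v x
    · rw [norm_zero]; positivity
  have hfib := hs.hasSum.prod_fiberwise (g := fun l₁ =>
      H.pathHop z l₁ * ddPowExp 0 (-(u : ℂ)) (H.pathSeg z l₁) *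
      ((H.D₀ (H.permProd l₁ z) : ℂ) *
        NormedSpace.exp (-(v : ℂ) • H.mat) z' (H.permProd l₁ z))) (fun l₁ => by
    have := ((H.hasSum_path_exp 0 (-(v : ℂ)) (H.permProd l₁ z) z').mul_left
      (H.D₀ (H.permProd l₁ z) : ℂ)).mul_left
      (H.pathHop z l₁ * ddPowExp 0 (-(u : ℂ)) (H.pathSeg z l₁))
    rw [pow_zero, one_mul] at this
    refine this.congr_fun fun l₂ => ?_
    simp only [hF, pairTerm]
    split_ifs <;> simp)
  have hout : HasSum (fun l₁ => H.pathHop z l₁ * ddPowExp 0 (-(u : ℂ)) (H.pathSeg z l₁) *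
      ((H.D₀ (H.permProd l₁ z) : ℂ) *
        NormedSpace.exp (-(v : ℂ) • H.mat) z' (H.permProd l₁ z)))
      ((NormedSpace.exp (-(v : ℂ) • H.mat) * H.diagMat * NormedSpace.exp (-(u : ℂ) • H.mat))
        z' z) := by
    have h1 := hasSum_sum (s := Finset.univ) fun (x : ι) _ =>
      (H.hasSum_path_exp 0 (-(u : ℂ)) z x).mul_left
        (NormedSpace.exp (-(v : ℂ) • H.mat) z' x * (H.D₀ x : ℂ))
    convert! h1 using 1
    · funext l
      rw [Finset.sum_eq_single (H.permProd l z)]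
      · rw [if_pos rfl]; ring
      · intro x _ hx
        rw [if_neg hx.symm, mul_zero]
      · simp
    · rw [Matrix.mul_apply]
      refine Finset.sum_congr rfl fun x _ => ?_
      rw [diagMat, Matrix.mul_diagonal, pow_zero, one_mul]
  have hS := hs.hasSum
  rw [hfib.unique hout] at hS
  refine (hasSum_list_split hS).congr_fun fun l => ?_
  rw [pathHop_mul_pathSplit]
  have hl : ∀ r, H.permProd (l.drop r) (H.permProd (l.take r) z) = H.permProd l z := fun r => by
    rw [← permProd_append, List.take_append_drop]
  simp only [hF, hl]
  split_ifs <;> simp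

end PMR

end PMRQMC

namespace PMRQMC

open Filter Topology

namespace PMR

variable {ι : Type*} {M : ℕ} {H : PMR ι M}

/-! ### Sums over configurations -/

lemma permProd_mem (l : List (Fin M)) : H.permProd l ∈ H.G := by
  refine Subgroup.list_prod_mem _ fun x hx => ?_
  simp only [List.mem_reverse, List.mem_map] at hx
  obtain ⟨j, -, rfl⟩ := hx
  exact H.P_mem j

/-- This is the role of simple transitivity: a path that returns to its start multiplies to the
identity, so closed paths are configurations. -/
lemma permProd_eq_one_of_fixed {l : List (Fin M)} {z : ι} (h : H.permProd l z = z) :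
    H.permProd l = 1 :=
  (H.simplyTransitive z z).unique ⟨permProd_mem l, h⟩ ⟨H.G.one_mem, rfl⟩

lemma Config.permProd_apply (C : H.Config) : H.permProd C.idx C.z = C.z := by
  rw [C.closed]; rfl

/-- A configuration as a basis state and a list of indices. -/
def Config.toPair (C : H.Config) : ι × List (Fin M) := (C.z, C.idx)

lemma Config.toPair_injective : Function.Injective (Config.toPair (H := H)) := by
  rintro ⟨z, l, h⟩ ⟨z', l', h'⟩ he
  simp only [Config.toPair, Prod.mk.injEq] at he
  obtain ⟨rfl, rfl⟩ := he
  rfl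

instance [Countable ι] : Countable H.Config := Config.toPair_injective.countable

lemma hasSum_config [Fintype ι] [DecidableEq ι] {f : ι → List (Fin M) → ℂ} {s : ι → ℂ}
    (h : ∀ z, HasSum (fun l => if H.permProd l z = z then f z l else 0) (s z)) :
    HasSum (fun C : H.Config => f C.z C.idx) (∑ z, s z) := by
  set g : ι × List (Fin M) → ℂ := fun x => if H.permProd x.2 x.1 = x.1 then f x.1 x.2 else 0 with hg
  have hz : ∀ z, HasSum (fun x : ι × List (Fin M) => if x.1 = z then g x else 0) (s z) := by
    intro z
    have hinj : Function.Injective (fun l : List (Fin M) => (z, l)) := Prod.mk_right_injective z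
    refine (hinj.hasSum_iff ?_).1 (by simpa [Function.comp_def, hg] using h z)
    rintro ⟨z', l⟩ hx
    rw [if_neg]
    rintro rfl
    exact hx ⟨l, rfl⟩
  have hgs : HasSum g (∑ z, s z) := by
    refine (hasSum_sum (s := Finset.univ) fun z _ => hz z).congr_fun fun x => ?_
    simp
  have hcomp : HasSum (g ∘ Config.toPair (H := H)) (∑ z, s z) := by
    refine (Function.Injective.hasSum_iff Config.toPair_injective ?_).2 hgs
    rintro ⟨z, l⟩ hx
    simp only [hg]
    rw [if_neg]
    intro hl
    exact hx ⟨⟨z, l, permProd_eq_one_of_fixed hl⟩, rfl⟩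
  refine hcomp.congr_fun fun C => ?_
  simp only [hg, Function.comp, Config.toPair, C.permProd_apply, if_true]

lemma summable_config_pow [Fintype ι] {u : ℝ} (hu : 0 ≤ u) (h : M * u < 1) :
    Summable (fun C : H.Config => u ^ C.idx.length) := by
  have h1 : Summable (fun x : ι × List (Fin M) => (1 : ℝ) * u ^ x.2.length) :=
    (Summable.of_finite (f := fun _ : ι => (1 : ℝ))).mul_of_nonneg (summable_pow_length M hu h)
      (fun _ => zero_le_one) (fun l => by positivity)
  simpa [Function.comp_def, Config.toPair] using h1.comp_injective
    (Config.toPair_injective (H := H))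

lemma prod_hop_eq_pathHop (z : ι) (l : List (Fin M)) :
    ∏ k : Fin l.length, H.D (l.get k) (H.permProd (l.take (k + 1)) z) = H.pathHop z l := by
  induction l generalizing z with
  | nil => simp [pathHop]
  | cons j l ih =>
    rw [pathHop, ← ih (H.P j z)]
    simp only [List.length_cons]
    rw [Fin.prod_univ_succ]
    congr 1
    simp [permProd_cons]

lemma Config.hop_eq (C : H.Config) : C.hop = H.pathHop C.z C.idx :=
  prod_hop_eq_pathHop C.z C.idx

lemma Config.energy_eq (C : H.Config) : C.energy = H.pathEnergy C.z C.idx := rfl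

lemma Config.energy_zero (C : H.Config) : C.energy 0 = H.D₀ C.z := by
  simp [energy_eq, pathEnergy]

/-- Closedness reconciles formulas that peel the last energy with `D₀` acting at the initial state.
-/
lemma Config.energy_q (C : H.Config) : C.energy C.q = H.D₀ C.z := by
  rw [energy_eq, pathEnergy, Config.q, List.take_length, C.permProd_apply]

lemma Config.weight_mul (β : ℝ) (C : H.Config) (x : ℂ) :
    C.weight β * x = H.pathHop C.z C.idx * (ddExp (-β) (seg C.energy 0 C.q) * x) := by
  rw [Config.weight, hop_eq, mul_assoc]

end PMR

/-! ### Estimators multiplied by the divided difference in the weight -/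

variable {E : ℕ → ℝ} {β : ℝ}

lemma ddExp_seg_eq_thermalDD (β : ℝ) (E : ℕ → ℝ) (a b : ℕ) :
    ddExp (-β) (seg E a b) = thermalDD E 0 a (b + 1) β := by
  rw [ddExp_eq, seg_eq_icoSeg, thermalDD]

lemma ddExp_half_seg_eq_thermalDD (β : ℝ) (E : ℕ → ℝ) (a b : ℕ) :
    ddExp (-β / 2) (seg E a b) = thermalDD E 0 a (b + 1) (β / 2) := by
  rw [ddExp_eq, seg_eq_icoSeg, thermalDD]; congr 1; push_cast; ring

lemma thermalDD_ne_zero (hβ : 0 < β) (q : ℕ) : thermalDD E 0 0 (q + 1) β ≠ 0 := by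
  rw [← ddExp_seg_eq_thermalDD]; exact ddExp_seg_ne_zero q hβ

/-- The denominator cancels against the weight, and peeling the last energy identifies the rest; for
`q = 0` the shortened interval is empty, in agreement with the indicator. -/
lemma mul_offEst (hβ : 0 < β) (q : ℕ) :
    ddExp (-β) (seg E 0 q) * offEst β q E =
      thermalDD E 1 0 (q + 1) β - E q * thermalDD E 0 0 (q + 1) β := by
  have h := thermalDD_ne_zero (E := E) hβ q
  rw [thermalDD_succ_right q.zero_le, add_sub_cancel_left, offEst]
  simp only [ddExp_seg_eq_thermalDD]
  split_ifs with hq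
  · rw [mul_div_cancel₀ _ h, Nat.sub_add_cancel hq]
  · rw [mul_zero, thermalDD_of_le (by omega)]

lemma mul_hsqEst (hβ : 0 < β) (q : ℕ) :
    ddExp (-β) (seg E 0 q) * hsqEst β q E = thermalDD E 2 0 (q + 1) β := by
  have h := thermalDD_ne_zero (E := E) hβ q
  rw [thermalDD_succ_right q.zero_le, thermalDD_succ_right q.zero_le, hsqEst]
  simp only [ddExp_seg_eq_thermalDD]
  rw [mul_add, mul_div_cancel₀ _ h]
  -- The last energy is peeled twice; `q = 0` and `q = 1` are the cases where an indicator vanishes.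
  rcases q with _ | _ | q
  · simp [thermalDD_of_le]; ring
  · rw [thermalDD_succ_right (le_refl 0), thermalDD_of_le (le_refl 0)]
    simp; ring
  · rw [thermalDD_succ_right (Nat.zero_le (q + 1))]
    simp; ring

lemma mul_d0hEst (hβ : 0 < β) (q : ℕ) :
    ddExp (-β) (seg E 0 q) * d0hEst β q E = E 0 * thermalDD E 1 0 (q + 1) β := by
  have h := thermalDD_ne_zero (E := E) hβ q
  rw [thermalDD_succ_left q.succ_pos, d0hEst]
  simp only [ddExp_seg_eq_thermalDD]
  split_ifs with hq
  · field_simp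
  · rw [thermalDD_of_le (a := 0 + 1) (by omega)]; ring

lemma mul_fsEst (hβ : 0 < β) (q : ℕ) :
    ddExp (-β) (seg E 0 q) * fsEst β q E = E 0 *
      ∫ τ in (0 : ℝ)..(β / 2), (τ : ℂ) * ∑ r ∈ Finset.range (q + 1),
        (E r : ℂ) * (thermalDD E 0 0 (r + 1) (β - τ) * thermalDD E 0 r (q + 1) τ) := by
  have h := thermalDD_ne_zero (E := E) hβ q
  have hint := integral_mul_sum_energy (E := E) q (β / 2)
  rw [mul_div_cancel₀ β two_ne_zero] at hint
  rw [hint, fsEst]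
  split_ifs with hq
  · subst hq
    -- For `q = 0` there is one energy, and the two half-period exponentials recombine into the
    -- weight.
    have h1 := thermalDD_add (E := E) (show 0 < 0 + 1 by omega) (β / 2) (β / 2)
    simp only [zero_add, Nat.Ico_succ_singleton, Finset.sum_singleton, add_halves] at h1
    rw [ddExp_seg_eq_thermalDD]
    simp only [zero_add, Finset.range_one, Finset.sum_singleton, Finset.Ico_self, Finset.sum_empty,
      sub_zero]
    rw [thermalDD_succ_left zero_lt_one, thermalDD_of_le (a := 0 + 1) (b := 1) le_rfl, ← h1]
    push_cast; ring
  · rw [ddExp_seg_eq_thermalDD, ← mul_assoc, mul_div_cancel₀ _ h]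
    congr 1
    refine Finset.sum_congr rfl fun r hr => ?_
    have hr' : r < q + 1 := Finset.mem_range.1 hr
    simp only [ddExp_half_seg_eq_thermalDD]
    rw [thermalDD_succ_left hr']
    congr 1
    have hI : Finset.Ico (r + 1) (q + 1) = Finset.Icc (r + 1) q := rfl
    rw [hI]
    congr 1
    · push_cast; ring
    · refine Finset.sum_congr rfl fun i _ => ?_
      rw [ddExp_eq, seg_eq_icoSeg]
      congr 2; push_cast; ring

end PMRQMC

namespace PMRQMC

open Filter Topology

/-! ### Thermal averages -/

section Thermal

variable {ι : Type*} [Fintype ι] [DecidableEq ι]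

lemma continuous_exp_smul (A : Matrix ι ι ℂ) :
    Continuous (fun τ : ℝ => NormedSpace.exp ((τ : ℂ) • A)) := by
  open scoped Matrix.Norms.Operator in
  exact (NormedSpace.exp_continuous (𝔸 := Matrix ι ι ℂ)).comp
    (Complex.continuous_ofReal.smul continuous_const)

lemma exp_smul_mul_exp_smul (A : Matrix ι ι ℂ) (s t : ℂ) :
    NormedSpace.exp (s • A) * NormedSpace.exp (t • A) = NormedSpace.exp ((s + t) • A) := by
  rw [add_smul, Matrix.exp_add_of_commute]
  exact ((Commute.refl A).smul_left s).smul_right t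

lemma commute_exp_smul (A : Matrix ι ι ℂ) (t : ℂ) : Commute A (NormedSpace.exp (t • A)) :=
  (((Commute.refl A).smul_right t)).exp_right

open scoped ComplexOrder in
-- The exponential is `Bᴴ * B` with `B = exp (-(β/2) A)` Hermitian and invertible, so its trace
-- vanishes only if `B = 0`.
lemma trace_exp_ne_zero [Nonempty ι] {A : Matrix ι ι ℂ} (hA : A.IsHermitian) (β : ℝ) :
    (NormedSpace.exp (-(β : ℂ) • A)).trace ≠ 0 := by
  set B := NormedSpace.exp (((-(β / 2) : ℝ) : ℂ) • A) with hB
  have hBH : B.IsHermitian := by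
    refine Matrix.IsHermitian.exp ?_
    rw [Matrix.IsHermitian, Matrix.conjTranspose_smul, hA]
    simp
  have h1 : NormedSpace.exp (-(β : ℂ) • A) = Matrix.conjTranspose B * B := by
    rw [hBH, hB, exp_smul_mul_exp_smul]
    congr 2; push_cast; ring
  rw [h1, Ne, Matrix.trace_conjTranspose_mul_self_eq_zero_iff]
  intro h0
  have hu : IsUnit B := Matrix.isUnit_exp _
  rw [h0] at hu
  exact not_isUnit_zero hu

/-- By cyclicity the growing factor `exp (τ H)` merges with `exp (-β H)`. -/
lemma trace_evolve_mul (A B H : Matrix ι ι ℂ) (β τ : ℝ) :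
    (evolve H τ A * B * NormedSpace.exp (-(β : ℂ) • H)).trace =
      (A * NormedSpace.exp (-(τ : ℂ) • H) * B *
        NormedSpace.exp (-((β - τ : ℝ) : ℂ) • H)).trace := by
  rw [evolve, Matrix.mul_assoc, Matrix.mul_assoc, Matrix.mul_assoc, Matrix.trace_mul_comm]
  simp only [Matrix.mul_assoc]
  rw [exp_smul_mul_exp_smul, show -(β : ℂ) + τ = -((β - τ : ℝ) : ℂ) by push_cast; ring]

end Thermal

namespace PMR

variable {ι : Type*} {M : ℕ} {H : PMR ι M} [Fintype ι] [DecidableEq ι]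

lemma hasSum_config_exp (c : ι → ℂ) (p : ℕ) (β : ℝ) :
    HasSum (fun C : H.Config => H.pathHop C.z C.idx *
        (c C.z * thermalDD C.energy p 0 (C.q + 1) β))
      (Matrix.diagonal c * (H.mat ^ p * NormedSpace.exp (-(β : ℂ) • H.mat))).trace := by
  rw [Matrix.trace]
  refine hasSum_config (f := fun z l => H.pathHop z l *
    (c z * ddPowExp p (-(β : ℂ)) (H.pathSeg z l))) fun z => ?_
  rw [Matrix.diag_apply, Matrix.diagonal_mul]
  refine ((H.hasSum_path_exp p (-(β : ℂ)) z z).mul_left (c z)).congr_fun fun l => ?_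
  split_ifs <;> ring

lemma hasSum_weight (β : ℝ) :
    HasSum (fun C : H.Config => C.weight β) (NormedSpace.exp (-(β : ℂ) • H.mat)).trace := by
  have h := hasSum_config_exp (H := H) (fun _ => 1) 0 β
  rw [Matrix.diagonal_one, one_mul, pow_zero, one_mul] at h
  refine h.congr_fun fun C => ?_
  rw [← mul_one (C.weight β), Config.weight_mul, ddExp_seg_eq_thermalDD, mul_one, one_mul]

lemma isEstimator_of_hasSum [Nonempty ι] (hH : H.mat.IsHermitian) {β : ℝ} {O : H.Config → ℂ}
    {S : ℂ} (h : HasSum (fun C : H.Config => C.weight β * O C) S) :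
    H.IsEstimator β O (S / (NormedSpace.exp (-(β : ℂ) • H.mat)).trace) := by
  have hw := hasSum_weight (H := H) β
  refine ⟨hw.summable.norm, h.summable.norm, ?_, ?_⟩
  · rw [hw.tsum_eq]; exact trace_exp_ne_zero hH β
  · rw [mean, h.tsum_eq, hw.tsum_eq]

variable {β : ℝ}

lemma isEstimator_d0Est [Nonempty ι] (hH : H.mat.IsHermitian) :
    H.IsEstimator β (H.atConfig β d0Est) (thermalAvg H.mat β H.diagMat) := by
  refine isEstimator_of_hasSum hH ?_
  have h := hasSum_config_exp (H := H) (fun z => (H.D₀ z : ℂ)) 0 β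
  rw [pow_zero, one_mul] at h
  refine h.congr_fun fun C => ?_
  rw [Config.weight_mul, ddExp_seg_eq_thermalDD, atConfig, d0Est, C.energy_zero]; ring

lemma isEstimator_offEst [Nonempty ι] (hH : H.mat.IsHermitian) (hβ : 0 < β) :
    H.IsEstimator β (H.atConfig β offEst) (thermalAvg H.mat β (H.mat - H.diagMat)) := by
  refine isEstimator_of_hasSum hH ?_
  have h := (hasSum_config_exp (H := H) (fun _ => 1) 1 β).sub
    (hasSum_config_exp (H := H) (fun z => (H.D₀ z : ℂ)) 0 β)
  rw [Matrix.diagonal_one, one_mul, pow_zero, one_mul, pow_one, ← Matrix.trace_sub,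
    ← diagMat, ← sub_mul] at h
  refine h.congr_fun fun C => ?_
  rw [Config.weight_mul, atConfig, mul_offEst hβ, C.energy_q]; ring

lemma isEstimator_hsqEst [Nonempty ι] (hH : H.mat.IsHermitian) (hβ : 0 < β) :
    H.IsEstimator β (H.atConfig β hsqEst) (thermalAvg H.mat β (H.mat * H.mat)) := by
  refine isEstimator_of_hasSum hH ?_
  have h := hasSum_config_exp (H := H) (fun _ => 1) 2 β
  rw [Matrix.diagonal_one, one_mul, pow_two] at h
  refine h.congr_fun fun C => ?_
  rw [Config.weight_mul, atConfig, mul_hsqEst hβ, one_mul]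

lemma isEstimator_d0hEst [Nonempty ι] (hH : H.mat.IsHermitian) (hβ : 0 < β) :
    H.IsEstimator β (H.atConfig β d0hEst) (thermalAvg H.mat β (H.diagMat * H.mat)) := by
  refine isEstimator_of_hasSum hH ?_
  have h := hasSum_config_exp (H := H) (fun z => (H.D₀ z : ℂ)) 1 β
  rw [pow_one, ← diagMat, ← mul_assoc] at h
  refine h.congr_fun fun C => ?_
  rw [Config.weight_mul, atConfig, mul_d0hEst hβ, C.energy_zero]

lemma hasSum_config_split (u v : ℝ) :
    HasSum (fun C : H.Config => H.D₀ C.z * (H.pathHop C.z C.idx * H.pathSplit C.z C.idx u v))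
      (H.diagMat * NormedSpace.exp (-(v : ℂ) • H.mat) * H.diagMat *
        NormedSpace.exp (-(u : ℂ) • H.mat)).trace := by
  rw [Matrix.mul_assoc, Matrix.mul_assoc, Matrix.trace]
  refine hasSum_config (f := fun z l => (H.D₀ z : ℂ) *
    (H.pathHop z l * H.pathSplit z l u v)) fun z => ?_
  rw [Matrix.diag_apply, diagMat, Matrix.diagonal_mul, ← Matrix.mul_assoc]
  refine ((H.hasSum_path_split u v z z).mul_left (H.D₀ z : ℂ)).congr_fun fun l => ?_
  split_ifs <;> ring

/-- Summation over configurations commutes with the imaginary time integral. -/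
lemma hasSum_integral_config_split (hβ : 0 < β) :
    HasSum (fun C : H.Config => ∫ τ in (0 : ℝ)..(β / 2),
        (τ : ℂ) * (H.D₀ C.z * (H.pathHop C.z C.idx * H.pathSplit C.z C.idx (β - τ) τ)))
      (∫ τ in (0 : ℝ)..(β / 2), (τ : ℂ) *
        (evolve H.mat τ H.diagMat * H.diagMat * NormedSpace.exp (-(β : ℂ) • H.mat)).trace) := by
  obtain ⟨Λ, μ, w, hΛ0, hμ, hw, hMw, hΛ, hhop⟩ := H.exists_path_bound
  have hs := summable_config_pow (H := H) (u := 2 * w) (by positivity) hMw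
  -- Both durations are at most `β` in absolute value on the integration range, so one bound serves
  -- all `τ`.
  set K := Λ * (Real.exp (β * (Λ + μ)) * Real.exp (β * (Λ + μ))) with hK
  refine intervalIntegral.hasSum_integral_of_dominated_convergence
    (fun C _ => β * (Λ * ((2 * w) ^ C.idx.length * K))) (fun C => ?_) (fun C => ?_) ?_ ?_ ?_
  · exact (Complex.continuous_ofReal.mul (continuous_const.mul
      (continuous_const.mul (continuous_pathSplit _ _ _)))).aestronglyMeasurable
  · refine Eventually.of_forall fun τ hτ => ?_
    rw [Set.uIoc_of_le (by positivity)] at hτ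
    have h1 := norm_pathHop_mul_pathSplit_le hμ hw hΛ hhop C.z C.idx (β - τ) τ
    have h2 : |β - τ| ≤ β := by rw [abs_le]; constructor <;> linarith [hτ.1, hτ.2]
    have h3 : |τ| ≤ β := by rw [abs_le]; constructor <;> linarith [hτ.1, hτ.2]
    rw [norm_mul, norm_mul, Complex.norm_real, Complex.norm_real, Real.norm_eq_abs,
      Real.norm_eq_abs]
    gcongr
    · exact hΛ _
    · refine h1.trans ?_
      simp only [hK]
      gcongr
  · exact Eventually.of_forall fun τ _ => ((hs.mul_right K).mul_left Λ).mul_left β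
  · exact intervalIntegrable_const
  · refine Eventually.of_forall fun τ _ => ?_
    rw [trace_evolve_mul]
    exact (hasSum_config_split (β - τ) τ).mul_left (τ : ℂ)

lemma isEstimator_fsEst [Nonempty ι] (hH : H.mat.IsHermitian) (hβ : 0 < β) :
    H.IsEstimator β (H.atConfig β fsEst)
      (∫ τ in (0 : ℝ)..(β / 2),
        (τ : ℂ) * thermalAvg H.mat β (evolve H.mat τ H.diagMat * H.diagMat)) := by
  simp only [thermalAvg, ← mul_div_assoc]
  rw [intervalIntegral.integral_div]
  refine isEstimator_of_hasSum hH ((hasSum_integral_config_split hβ).congr_fun fun C => ?_)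
  rw [Config.weight_mul, atConfig, mul_fsEst hβ, C.energy_zero, ← mul_assoc,
    ← intervalIntegral.integral_const_mul]
  refine intervalIntegral.integral_congr fun τ _ => ?_
  simp only [pathSplit, Config.energy_eq, Config.q]
  ring

end PMR

/-! ### The fidelity susceptibility -/

section FidelitySusceptibility

variable {ι : Type*} [Fintype ι] [DecidableEq ι]

lemma continuous_thermalAvg_evolve (H A B : Matrix ι ι ℂ) (β : ℝ) :
    Continuous fun τ => thermalAvg H β (evolve H τ A * B) := by
  unfold thermalAvg evolve
  have h1 := continuous_exp_smul H
  have h2 : Continuous fun τ : ℝ => NormedSpace.exp (-(τ : ℂ) • H) := by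
    have h := (continuous_exp_smul H).comp continuous_neg
    simpa only [Function.comp_def, Complex.ofReal_neg] using h
  refine Continuous.div_const (Continuous.matrix_trace ?_) _
  exact (((h1.matrix_mul continuous_const).matrix_mul h2).matrix_mul
    continuous_const).matrix_mul continuous_const

lemma integral_mul_add_const {f : ℝ → ℂ} (hf : Continuous f) (β : ℝ) (x : ℂ) :
    ∫ τ in (0 : ℝ)..(β / 2), (τ : ℂ) * (f τ + x) =
      (∫ τ in (0 : ℝ)..(β / 2), (τ : ℂ) * f τ) + (β : ℂ) ^ 2 / 8 * x := by
  simp_rw [mul_add]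
  rw [intervalIntegral.integral_add, intervalIntegral.integral_mul_const,
    intervalIntegral.integral_ofReal, integral_id]
  · push_cast; ring
  · exact (Complex.continuous_ofReal.mul hf).intervalIntegrable _ _
  · exact (Complex.continuous_ofReal.mul continuous_const).intervalIntegrable _ _

lemma thermalAvg_smul (H : Matrix ι ι ℂ) (β : ℝ) (c : ℂ) (A : Matrix ι ι ℂ) :
    thermalAvg H β (c • A) = c * thermalAvg H β A := by
  rw [thermalAvg, thermalAvg, Matrix.smul_mul, Matrix.trace_smul, smul_eq_mul, mul_div_assoc]

lemma evolve_smul (H : Matrix ι ι ℂ) (τ : ℝ) (c : ℂ) (A : Matrix ι ι ℂ) :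
    evolve H τ (c • A) = c • evolve H τ A := by
  rw [evolve, evolve, Matrix.mul_smul, Matrix.smul_mul]

lemma fidSus_smul (H : Matrix ι ι ℂ) (β : ℝ) (c : ℂ) (A : Matrix ι ι ℂ) :
    fidSus H β (c • A) = c ^ 2 * ((∫ τ in (0 : ℝ)..(β / 2),
      (τ : ℂ) * thermalAvg H β (evolve H τ A * A)) - (β : ℂ) ^ 2 / 8 * thermalAvg H β A ^ 2) := by
  have h := integral_mul_add_const (continuous_thermalAvg_evolve H A A β) β (-thermalAvg H β A ^ 2)
  rw [mul_neg, ← sub_eq_add_neg] at h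
  rw [← h, fidSus, ← intervalIntegral.integral_const_mul]
  refine intervalIntegral.integral_congr fun τ _ => ?_
  simp only [evolve_smul, thermalAvg_smul, Matrix.smul_mul, Matrix.mul_smul]
  ring

/-- `H` commutes with its exponentials, so every term containing a factor `H` loses its dependence
on `τ`; the two cross terms agree by cyclicity of the trace. -/
lemma thermalAvg_evolve_sub (H A : Matrix ι ι ℂ) (β τ : ℝ) :
    thermalAvg H β (evolve H τ (H - A) * (H - A)) = thermalAvg H β (evolve H τ A * A) +
      (thermalAvg H β (H * H) - 2 * thermalAvg H β (A * H)) := by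
  have hc := fun t : ℂ => (commute_exp_smul H t).eq
  have hadd : NormedSpace.exp (-(τ : ℂ) • H) * NormedSpace.exp (-((β - τ : ℝ) : ℂ) • H) =
      NormedSpace.exp (-(β : ℂ) • H) := by
    rw [exp_smul_mul_exp_smul]; congr 2; push_cast; ring
  have hadd' : NormedSpace.exp (-((β - τ : ℝ) : ℂ) • H) * NormedSpace.exp (-(τ : ℂ) • H) =
      NormedSpace.exp (-(β : ℂ) • H) := by
    rw [exp_smul_mul_exp_smul]; congr 2; push_cast; ring
  simp only [thermalAvg, trace_evolve_mul]
  set U := NormedSpace.exp (-(τ : ℂ) • H) with hU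
  set V := NormedSpace.exp (-((β - τ : ℝ) : ℂ) • H) with hV
  rw [← hadd]
  have hUH : H * U = U * H := hc _
  have hVH : H * V = V * H := hc _
  have h1 : H * U * H * V = H * H * (U * V) := by
    rw [Matrix.mul_assoc H U, ← hUH]; simp only [Matrix.mul_assoc]
  have h2 : A * U * H * V = A * H * (U * V) := by
    rw [Matrix.mul_assoc A U, ← hUH]; simp only [Matrix.mul_assoc]
  have h3 : (H * U * A * V).trace = (A * H * (U * V)).trace := by
    rw [Matrix.mul_assoc (H * U), Matrix.trace_mul_comm, ← Matrix.mul_assoc, Matrix.mul_assoc A,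
      ← hVH, hadd, ← hadd']
    simp only [Matrix.mul_assoc]
  have h4 : (H - A) * U * (H - A) * V = H * U * H * V - A * U * H * V - H * U * A * V +
      A * U * A * V := by
    simp only [sub_mul, mul_sub]; abel
  rw [h4, Matrix.trace_add, Matrix.trace_sub, Matrix.trace_sub, h1, h2, h3]
  ring

end FidelitySusceptibility

end PMRQMC

namespace PMRQMC

/-! ### Verification of programs -/

/-- Straight-line programs. -/
def block : List Instr → Prog
  -- A no-op on an index register used nowhere else; a block thus costs one step beyond its
  -- instructions.
  | [] => .instr (.ixConst 9 0)
  | i :: l => .seq (.instr i) (block l)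

/-- The number of iterations is read on entry. Each iteration carries one step of overhead, and the
loop itself one more. -/
lemma Prog.loop_spec {a c : ℕ} {p : Prog} {Inv : ℕ → State → Prop} {s : State} (h0 : Inv 0 s)
    (hstep : ∀ k s', k < s.ix a → Inv k s' → Inv (k + 1) (p.run s').1 ∧ (p.run s').2 ≤ c) :
    Inv (s.ix a) ((Prog.loop a p).run s).1 ∧
      ((Prog.loop a p).run s).2 ≤ s.ix a * (c + 1) + 1 := by
  have key : ∀ n ≤ s.ix a,
      Inv n ((fun x : State × ℕ => ((p.run x.1).1, x.2 + (p.run x.1).2 + 1))^[n] (s, 1)).1 ∧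
      ((fun x : State × ℕ => ((p.run x.1).1, x.2 + (p.run x.1).2 + 1))^[n] (s, 1)).2 ≤
        n * (c + 1) + 1 := by
    intro n
    induction n with
    | zero => intro _; simpa using h0
    | succ n ih =>
      intro hn
      obtain ⟨h1, h2⟩ := ih (by omega)
      obtain ⟨h3, h4⟩ := hstep n _ (by omega) h1
      rw [Function.iterate_succ_apply']
      exact ⟨h3, by rw [add_mul, one_mul]; omega⟩
  exact key _ le_rfl

lemma Prog.seq_spec {p r : Prog} {P Q : State → Prop} {c d : ℕ} {s : State}
    (hp : P (p.run s).1 ∧ (p.run s).2 ≤ c)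
    (hr : ∀ s', P s' → Q (r.run s').1 ∧ (r.run s').2 ≤ d) :
    Q ((Prog.seq p r).run s).1 ∧ ((Prog.seq p r).run s).2 ≤ c + d :=
  ⟨(hr _ hp.1).1, add_le_add hp.2 (hr _ hp.1).2⟩

/-! ### The program -/

/-- Constants, and blank calculators. -/
def initBlock : Prog := block
  [.ixConst 1 1, .ixConst 2 0, .ixAdd 3 0 1, .ixConst 4 0, .const 5 (-1), .const 7 (1 / 2),
    .mul 6 5 0, .mul 8 6 7, .ddNew 0 6, .ddNew 1 8, .ddNew 2 8, .ddNew 3 6]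

/-- Adds one energy to the calculators. -/
def fillBlock : Prog := block [.load 9 4, .ddAdd 0 9, .ddAdd 1 9, .ddAdd 3 9, .ixAdd 4 4 1]

/-- Reads off the divided differences of the static estimators. -/
def readBlock : Prog := block
  [.ddRead 10 0, .load 1 2, .load 12 0, .ixSub 5 0 1, .load 13 5, .ddRemove 0 12, .ddRead 14 0,
    .ddRemove 0 13, .ddRead 15 0, .ddRemove 3 1, .ddRead 16 3]

/-- Computes the static estimators and prepares the main loop. -/
def staticBlock : Prog := block
  [.div 2 14 10, .add 17 12 13, .mul 17 17 14, .add 17 17 15, .div 17 17 10, .mul 18 12 12,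
    .add 3 18 17, .div 17 16 10, .add 17 1 17, .mul 4 1 17, .const 19 (1 / 8), .mul 24 0 0,
    .mul 24 24 19, .const 25 1, .const 20 0, .ixConst 6 0]

/-- Starts the summand with index `r`. -/
def outerHead : Prog := block
  [.load 21 6, .ddAdd 2 21, .ddRead 22 2, .ddRead 23 1, .ixSub 7 0 6, .ixAdd 8 6 1, .const 26 0,
    .const 27 0]

/-- Adds one term to the inner sum. -/
def innerBlock : Prog := block
  -- Register `27` carries `i - r` as a scalar; the repeated energy is removed right after reading,
  -- so each term costs a number of steps linear in `q`.
  [.load 28 8, .ddAdd 1 28, .ddRead 29 1, .ddRemove 1 28, .add 27 27 25, .mul 29 27 29,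
    .add 26 26 29, .ixAdd 8 8 1]

/-- Completes the summand with index `r`. -/
def outerTail : Prog := block
  [.ddRemove 1 21, .ddRead 30 1, .mul 31 24 21, .mul 31 31 23, .mul 32 24 30, .add 31 31 32,
    .sub 31 31 26, .mul 31 22 31, .add 20 20 31, .ixAdd 6 6 1]

/-- The result for `q = 0`. -/
def zeroBlock : Prog := block [.mul 33 0 1, .mul 33 33 33, .const 34 8, .div 0 33 34]

/-- The result for `q > 0`. -/
def posBlock : Prog := block [.div 33 1 10, .mul 0 33 20]

/-- One summand of the estimator of the fidelity susceptibility. -/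
def outerBody : Prog := .seq outerHead (.seq (.loop 7 innerBlock) outerTail)

/-- The program that evaluates all the estimators. -/
def estProg : Prog :=
  .seq initBlock <| .seq (.loop 3 fillBlock) <| .seq readBlock <| .seq staticBlock <|
    .seq (.loop 3 outerBody) (.ifZero 0 zeroBlock posBlock)

variable {β : ℝ} {q : ℕ} {E : ℕ → ℝ}

/-- The invariant of the loop that fills the calculators. -/
structure FillInv (β : ℝ) (q : ℕ) (E : ℕ → ℝ) (k : ℕ) (s : State) : Prop where
  ix0 : s.ix 0 = q
  ix1 : s.ix 1 = 1
  ix2 : s.ix 2 = 0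
  ix3 : s.ix 3 = q + 1
  ix4 : s.ix 4 = k
  arr : ∀ i ≤ q, s.arr i = E i
  reg0 : s.reg 0 = β
  par0 : s.par 0 = -β
  par1 : s.par 1 = -β / 2
  par2 : s.par 2 = -β / 2
  par3 : s.par 3 = -β
  inp0 : s.inp 0 = icoSeg E 0 k
  inp1 : s.inp 1 = icoSeg E 0 k
  inp2 : s.inp 2 = 0
  inp3 : s.inp 3 = icoSeg E 0 k

lemma initBlock_spec : FillInv β q E 0 (initBlock.run (initState β q E)).1 ∧
    (initBlock.run (initState β q E)).2 ≤ 13 := by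
  refine ⟨?_, by simp [initBlock, block, Prog.run, Instr.cost]⟩
  constructor <;>
    simp +contextual [initBlock, block, Prog.run, Instr.exec, initState, icoSeg_of_le,
      div_eq_mul_inv]

lemma fillBlock_spec (k : ℕ) (s : State) (hk : k < q + 1) (h : FillInv β q E k s) :
    FillInv β q E (k + 1) (fillBlock.run s).1 ∧ (fillBlock.run s).2 ≤ 3 * q + 12 := by
  obtain ⟨h0, h1, h2, h3, h4, ha, hr0, hp0, hp1, hp2, hp3, hi0, hi1, hi2, hi3⟩ := h
  have hE := icoSeg_right E k.zero_le
  have hk' := ha k (by omega)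
  constructor
  · constructor <;>
      simp +contextual [fillBlock, block, Prog.run, Instr.exec, *]
  · simp [fillBlock, block, Prog.run, Instr.exec, Instr.cost, *]
    omega

/-- The registers that stay fixed in the main loop. -/
structure Frame (β : ℝ) (q : ℕ) (E : ℕ → ℝ) (s : State) : Prop where
  ix0 : s.ix 0 = q
  ix1 : s.ix 1 = 1
  ix3 : s.ix 3 = q + 1
  arr : ∀ i ≤ q, s.arr i = E i
  reg0 : s.reg 0 = β
  reg1 : s.reg 1 = d0Est β q E
  reg2 : s.reg 2 = offEst β q E
  reg3 : s.reg 3 = hsqEst β q E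
  reg4 : s.reg 4 = d0hEst β q E
  reg10 : s.reg 10 = ddExp (-β) (seg E 0 q)
  reg24 : s.reg 24 = (β : ℂ) ^ 2 / 8
  reg25 : s.reg 25 = 1
  par1 : s.par 1 = -β / 2
  par2 : s.par 2 = -β / 2

/-- The inner sum in the estimator of the fidelity susceptibility. -/
noncomputable def innerSum (β : ℝ) (q : ℕ) (E : ℕ → ℝ) (r b : ℕ) : ℂ :=
  ∑ i ∈ Finset.Ico (r + 1) b, ((i : ℂ) - (r : ℂ)) * ddExp (-β / 2) ((E i : ℂ) ::ₘ seg E r q)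

/-- One summand in the estimator of the fidelity susceptibility. -/
noncomputable def outerTerm (β : ℝ) (q : ℕ) (E : ℕ → ℝ) (r : ℕ) : ℂ :=
  ddExp (-β / 2) (seg E 0 r) *
    ((β : ℂ) ^ 2 / 8 * E r * ddExp (-β / 2) (seg E r q)
      + (β : ℂ) ^ 2 / 8 * ddExp (-β / 2) (seg E (r + 1) q) - innerSum β q E r (q + 1))

/-- The invariant of the main loop. -/
structure OuterInv (β : ℝ) (q : ℕ) (E : ℕ → ℝ) (r : ℕ) (s : State) : Prop where
  frame : Frame β q E s
  ix6 : s.ix 6 = r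
  inp1 : s.inp 1 = icoSeg E r (q + 1)
  inp2 : s.inp 2 = icoSeg E 0 r
  reg20 : s.reg 20 = ∑ r' ∈ Finset.range r, outerTerm β q E r'

/-- The invariant of the inner loop. -/
structure InnerInv (β : ℝ) (q : ℕ) (E : ℕ → ℝ) (r k : ℕ) (s : State) : Prop where
  frame : Frame β q E s
  ix6 : s.ix 6 = r
  ix8 : s.ix 8 = r + 1 + k
  inp1 : s.inp 1 = icoSeg E r (q + 1)
  inp2 : s.inp 2 = icoSeg E 0 (r + 1)
  reg20 : s.reg 20 = ∑ r' ∈ Finset.range r, outerTerm β q E r'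
  reg21 : s.reg 21 = E r
  reg22 : s.reg 22 = ddExp (-β / 2) (seg E 0 r)
  reg23 : s.reg 23 = ddExp (-β / 2) (seg E r q)
  reg26 : s.reg 26 = innerSum β q E r (r + 1 + k)
  reg27 : s.reg 27 = k

/-- The divided differences that enter the static estimators. -/
structure ReadInv (β : ℝ) (q : ℕ) (E : ℕ → ℝ) (s : State) : Prop where
  ix0 : s.ix 0 = q
  ix1 : s.ix 1 = 1
  ix3 : s.ix 3 = q + 1
  arr : ∀ i ≤ q, s.arr i = E i
  reg0 : s.reg 0 = β
  reg1 : s.reg 1 = E 0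
  reg10 : s.reg 10 = ddExp (-β) (seg E 0 q)
  reg12 : s.reg 12 = E q
  reg13 : s.reg 13 = E (q - 1)
  reg14 : s.reg 14 = ddExp (-β) (icoSeg E 0 q)
  reg15 : s.reg 15 = ddExp (-β) (icoSeg E 0 (q - 1))
  reg16 : s.reg 16 = ddExp (-β) (icoSeg E 1 (q + 1))
  par1 : s.par 1 = -β / 2
  par2 : s.par 2 = -β / 2
  inp1 : s.inp 1 = icoSeg E 0 (q + 1)
  inp2 : s.inp 2 = 0

/-- Valid for `q = 0` too: truncated subtraction loads `E 0`, and removal from an empty calculator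
changes nothing. -/
lemma erase_icoSeg_last (E : ℕ → ℝ) (q : ℕ) :
    (icoSeg E 0 q).erase (E (q - 1) : ℂ) = icoSeg E 0 (q - 1) := by
  rcases q with _ | q
  · simp [icoSeg_of_le]
  · rw [icoSeg_right E q.zero_le, Nat.add_sub_cancel, Multiset.erase_cons_head]

lemma erase_icoSeg_top (E : ℕ → ℝ) (q : ℕ) :
    (icoSeg E 0 (q + 1)).erase (E q : ℂ) = icoSeg E 0 q :=
  erase_icoSeg_last E (q + 1)

lemma erase_icoSeg_first (E : ℕ → ℝ) {a b : ℕ} (h : a < b) :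
    (icoSeg E a b).erase (E a : ℂ) = icoSeg E (a + 1) b := by
  rw [icoSeg_left E h, Multiset.erase_cons_head]

lemma readBlock_spec (s : State) (h : FillInv β q E (q + 1) s) :
    ReadInv β q E (readBlock.run s).1 ∧ (readBlock.run s).2 ≤ 3 * q + 20 := by
  obtain ⟨h0, h1, h2, h3, h4, ha, hr0, hp0, hp1, hp2, hp3, hi0, hi1, hi2, hi3⟩ := h
  have hk := ha q le_rfl
  have hk1 := ha (q - 1) (by omega)
  have hk0 := ha 0 q.zero_le
  have he1 := erase_icoSeg_top E q
  have he2 := erase_icoSeg_last E q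
  have he3 := erase_icoSeg_first E q.succ_pos
  constructor
  · constructor <;>
      simp +contextual [readBlock, block, Prog.run, Instr.exec, seg_eq_icoSeg, *]
  · simp [readBlock, block, Prog.run, Instr.exec, Instr.cost, *]
    omega

lemma ddExp_zero_right (t : ℂ) : ddExp t 0 = 0 := by rw [ddExp_eq, ddPowExp_zero_right]

/-- Empty divided differences vanish, so the indicators are automatic and the program needs no
branch for the static estimators. -/
lemma offEst_eq (β : ℝ) (q : ℕ) (E : ℕ → ℝ) :
    offEst β q E = ddExp (-β) (icoSeg E 0 q) / ddExp (-β) (seg E 0 q) := by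
  rcases q with _ | q
  · simp [offEst, icoSeg_of_le, ddExp_zero_right]
  · simp [offEst, seg_eq_icoSeg]

lemma hsqEst_eq (β : ℝ) (q : ℕ) (E : ℕ → ℝ) :
    hsqEst β q E = (E q : ℂ) * E q + (((E q : ℂ) + E (q - 1)) * ddExp (-β) (icoSeg E 0 q) +
      ddExp (-β) (icoSeg E 0 (q - 1))) / ddExp (-β) (seg E 0 q) := by
  rcases q with _ | _ | q
  · simp [hsqEst, icoSeg_of_le, ddExp_zero_right, pow_two]
  · simp [hsqEst, icoSeg_of_le, ddExp_zero_right, pow_two, seg_eq_icoSeg]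
  · simp [hsqEst, pow_two, seg_eq_icoSeg]

lemma d0hEst_eq (β : ℝ) (q : ℕ) (E : ℕ → ℝ) :
    d0hEst β q E = (E 0 : ℂ) * ((E 0 : ℂ) +
      ddExp (-β) (icoSeg E 1 (q + 1)) / ddExp (-β) (seg E 0 q)) := by
  rcases q with _ | q
  · simp [d0hEst, icoSeg_of_le, ddExp_zero_right]
  · simp [d0hEst, seg_eq_icoSeg]

lemma staticBlock_spec (s : State) (h : ReadInv β q E s) :
    OuterInv β q E 0 (staticBlock.run s).1 ∧ (staticBlock.run s).2 ≤ 17 := by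
  obtain ⟨h0, h1, h3, ha, hr0, hr1, hr10, hr12, hr13, hr14, hr15, hr16, hp1, hp2, hi1, hi2⟩ := h
  refine ⟨⟨?_, ?_, ?_, ?_, ?_⟩, ?_⟩
  · constructor <;>
      simp +contextual [staticBlock, block, Prog.run, Instr.exec, d0Est, offEst_eq, hsqEst_eq,
        d0hEst_eq, pow_two, div_eq_mul_inv, *]
  all_goals simp [staticBlock, block, Prog.run, Instr.exec, Instr.cost, icoSeg_of_le, *]

lemma innerSum_succ (β : ℝ) (q : ℕ) (E : ℕ → ℝ) (r k : ℕ) :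
    innerSum β q E r (r + 1 + k) + ((k : ℂ) + 1) *
      ddExp (-β / 2) ((E (r + 1 + k) : ℂ) ::ₘ icoSeg E r (q + 1)) =
      innerSum β q E r (r + 1 + (k + 1)) := by
  rw [innerSum, innerSum, ← add_assoc, Finset.sum_Ico_succ_top (by omega), seg_eq_icoSeg]
  congr 2
  push_cast; ring

lemma innerBlock_spec (r k : ℕ) (s : State) (hk : k < q - r) (h : InnerInv β q E r k s) :
    InnerInv β q E r (k + 1) (innerBlock.run s).1 ∧ (innerBlock.run s).2 ≤ 2 * q + 13 := by
  obtain ⟨⟨h0, h1, h3, ha, hr0, hr1, hr2, hr3, hr4, hr10, hr24, hr25, hp1, hp2⟩,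
    h6, h8, hi1, hi2, hr20, hr21, hr22, hr23, hr26, hr27⟩ := h
  have hE := ha (r + 1 + k) (by omega)
  have hs := innerSum_succ β q E r k
  refine ⟨⟨?_, ?_, ?_, ?_, ?_, ?_, ?_, ?_, ?_, ?_, ?_⟩, ?_⟩
  · constructor <;> simp +contextual [innerBlock, block, Prog.run, Instr.exec, *]
  · simp [innerBlock, block, Prog.run, Instr.exec, *]
  · simp [innerBlock, block, Prog.run, Instr.exec, *, add_assoc]
  all_goals simp [innerBlock, block, Prog.run, Instr.exec, Instr.cost, *]
  omega

lemma outerHead_spec (r : ℕ) (s : State) (hr : r < q + 1) (h : OuterInv β q E r s) :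
    InnerInv β q E r 0 (outerHead.run s).1 ∧ (outerHead.run s).1.ix 7 = q - r ∧
      (outerHead.run s).2 ≤ q + 11 := by
  obtain ⟨⟨h0, h1, h3, ha, hr0, hr1, hr2, hr3, hr4, hr10, hr24, hr25, hp1, hp2⟩,
    h6, hi1, hi2, hr20⟩ := h
  have hE := ha r (by omega)
  have hs := icoSeg_right E r.zero_le
  refine ⟨⟨?_, ?_, ?_, ?_, ?_, ?_, ?_, ?_, ?_, ?_, ?_⟩, ?_, ?_⟩
  · constructor <;> simp +contextual [outerHead, block, Prog.run, Instr.exec, *]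
  all_goals simp [outerHead, block, Prog.run, Instr.exec, Instr.cost, seg_eq_icoSeg, innerSum, *]
  omega

lemma outerTail_spec (r : ℕ) (s : State) (hr : r < q + 1) (h : InnerInv β q E r (q - r) s) :
    OuterInv β q E (r + 1) (outerTail.run s).1 ∧ (outerTail.run s).2 ≤ q + 13 := by
  obtain ⟨⟨h0, h1, h3, ha, hr0, hr1, hr2, hr3, hr4, hr10, hr24, hr25, hp1, hp2⟩,
    h6, h8, hi1, hi2, hr20, hr21, hr22, hr23, hr26, hr27⟩ := h
  have he := erase_icoSeg_first E hr
  rw [show r + 1 + (q - r) = q + 1 by omega] at hr26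
  refine ⟨⟨?_, ?_, ?_, ?_, ?_⟩, ?_⟩
  · constructor <;> simp +contextual [outerTail, block, Prog.run, Instr.exec, *]
  · simp [outerTail, block, Prog.run, Instr.exec, *]
  · simp [outerTail, block, Prog.run, Instr.exec, *]
  · simp [outerTail, block, Prog.run, Instr.exec, *]
  · simp [outerTail, block, Prog.run, Instr.exec, Finset.sum_range_succ, outerTerm,
      seg_eq_icoSeg, *]
  · simp [outerTail, block, Prog.run, Instr.exec, Instr.cost, *]
    omega

lemma outerBody_spec (r : ℕ) (s : State) (hr : r < q + 1) (h : OuterInv β q E r s) :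
    OuterInv β q E (r + 1) (outerBody.run s).1 ∧
      (outerBody.run s).2 ≤ q * (2 * q + 14) + (2 * q + 25) := by
  obtain ⟨h1, h7, c1⟩ := outerHead_spec r s hr h
  obtain ⟨h2, c2⟩ := Prog.loop_spec (a := 7) (Inv := InnerInv β q E r) h1
    (fun k s' hk hs' => innerBlock_spec r k s' (by rwa [h7] at hk) hs')
  rw [h7] at h2 c2
  obtain ⟨h3, c3⟩ := outerTail_spec r _ hr h2
  refine ⟨h3, ?_⟩
  -- At most `q` inner iterations of linear cost: one summand takes quadratic time.
  have hq : (q - r) * (2 * q + 13 + 1) ≤ q * (2 * q + 14) := Nat.mul_le_mul_right _ (by omega)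
  change _ + (_ + _) ≤ _
  omega

lemma fsEst_eq_sum (hq : q ≠ 0) : fsEst β q E = (E 0 : ℂ) / ddExp (-β) (seg E 0 q) *
    ∑ r ∈ Finset.range (q + 1), outerTerm β q E r := by
  rw [fsEst, if_neg hq]; rfl

/-- The outputs are the values of the estimators. -/
def IsOutput (β : ℝ) (q : ℕ) (E : ℕ → ℝ) (s : State) : Prop :=
  s.reg 0 = fsEst β q E ∧ s.reg 1 = d0Est β q E ∧ s.reg 2 = offEst β q E ∧
    s.reg 3 = hsqEst β q E ∧ s.reg 4 = d0hEst β q E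

lemma output_spec (s : State) (h : OuterInv β q E (q + 1) s) :
    IsOutput β q E ((Prog.ifZero 0 zeroBlock posBlock).run s).1 ∧
      ((Prog.ifZero 0 zeroBlock posBlock).run s).2 ≤ 6 := by
  obtain ⟨⟨h0, -, -, -, hr0, hr1, hr2, hr3, hr4, hr10, -, -, -, -⟩, -, -, -, hr20⟩ := h
  unfold IsOutput
  by_cases hq : q = 0
  · rw [← hr2, ← hr3, ← hr4, fsEst, if_pos hq, d0Est]
    rw [d0Est] at hr1
    simp [Prog.run, h0, hq, zeroBlock, block, Instr.exec, Instr.cost, hr0, hr1, pow_two]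
  · rw [fsEst_eq_sum hq, ← hr2, ← hr3, ← hr4, ← hr10, ← hr20, d0Est]
    rw [d0Est] at hr1
    simp [Prog.run, h0, hq, posBlock, block, Instr.exec, Instr.cost, hr1]

lemma estProg_spec (β : ℝ) (q : ℕ) (E : ℕ → ℝ) :
    IsOutput β q E (estProg.run (initState β q E)).1 ∧
      (estProg.run (initState β q E)).2 ≤ 200 * (q + 1) ^ 3 := by
  have fill : ∀ s, FillInv β q E 0 s → FillInv β q E (q + 1) ((Prog.loop 3 fillBlock).run s).1 ∧
      ((Prog.loop 3 fillBlock).run s).2 ≤ (q + 1) * (3 * q + 12 + 1) + 1 := by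
    intro s h
    have := Prog.loop_spec (a := 3) (Inv := FillInv β q E) h
      (fun k s' hk hs' => fillBlock_spec k s' (by rwa [h.ix3] at hk) hs')
    rwa [h.ix3] at this
  have outer : ∀ s, OuterInv β q E 0 s →
      OuterInv β q E (q + 1) ((Prog.loop 3 outerBody).run s).1 ∧
      ((Prog.loop 3 outerBody).run s).2 ≤
        (q + 1) * (q * (2 * q + 14) + (2 * q + 25) + 1) + 1 := by
    intro s h
    have := Prog.loop_spec (a := 3) (Inv := OuterInv β q E) h
      (fun k s' hk hs' => outerBody_spec k s' (by rwa [h.frame.ix3] at hk) hs')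
    rwa [h.frame.ix3] at this
  have h := Prog.seq_spec (initBlock_spec (β := β) (q := q) (E := E)) fun s hs =>
    Prog.seq_spec (fill s hs) fun s hs => Prog.seq_spec (readBlock_spec s hs) fun s hs =>
    Prog.seq_spec (staticBlock_spec s hs) fun s hs => Prog.seq_spec (outer s hs) output_spec
  refine ⟨h.1, h.2.trans ?_⟩
  -- The leading contribution is `(q + 1) * q * (2 * q + 14)`; the constant `200` is generous.
  nlinarith [Nat.zero_le (q ^ 3), Nat.zero_le (q ^ 2)]

end PMRQMC

open PMRQMC in
theorem theorem2 :
    -- One program evaluates the estimators in `O(q³)` steps, for every `β`, `q` and all energies.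
    (∃ (prog : Prog) (K : ℕ), ∀ (β : ℝ) (_ : 0 < β) (q : ℕ) (E : ℕ → ℝ),
      (prog.run (initState β q E)).2 ≤ K * (q + 1) ^ 3 ∧
      (prog.run (initState β q E)).1.reg 0 = fsEst β q E ∧
      (prog.run (initState β q E)).1.reg 1 = d0Est β q E ∧
      (prog.run (initState β q E)).1.reg 2 = offEst β q E ∧
      (prog.run (initState β q E)).1.reg 3 = hsqEst β q E ∧
      (prog.run (initState β q E)).1.reg 4 = d0hEst β q E) ∧
    ∀ (ι : Type*) [Fintype ι] [DecidableEq ι] [Nonempty ι] (M : ℕ) (H : PMR ι M)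
      (_ : H.mat.IsHermitian) (β : ℝ) (_ : 0 < β),
      -- The closed form is an exact estimator of `∫₀^{β/2} τ ⟨D₀(τ) D₀⟩ dτ`.
      H.IsEstimator β (H.atConfig β fsEst)
        (∫ τ in (0 : ℝ)..(β / 2),
          (τ : ℂ) * thermalAvg H.mat β (evolve H.mat τ H.diagMat * H.diagMat)) ∧
      -- The static estimators that complete it to the fidelity susceptibility.
      H.IsEstimator β (H.atConfig β d0Est) (thermalAvg H.mat β H.diagMat) ∧
      H.IsEstimator β (H.atConfig β offEst) (thermalAvg H.mat β (H.mat - H.diagMat)) ∧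
      H.IsEstimator β (H.atConfig β hsqEst) (thermalAvg H.mat β (H.mat * H.mat)) ∧
      H.IsEstimator β (H.atConfig β d0hEst) (thermalAvg H.mat β (H.diagMat * H.mat)) ∧
      -- The fidelity susceptibility for `H₁ = c D₀` and for `H₁ = c (H - D₀)`.
      (∀ (c : ℝ) (H₁ : Matrix ι ι ℂ), H₁ = (c : ℂ) • H.diagMat →
        fidSus H.mat β H₁ =
          (c : ℂ) ^ 2 * (H.mean β (H.atConfig β fsEst)
            - (β : ℂ) ^ 2 / 8 * H.mean β (H.atConfig β d0Est) ^ 2)) ∧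
      (∀ (c : ℝ) (H₁ : Matrix ι ι ℂ), H₁ = (c : ℂ) • (H.mat - H.diagMat) →
        fidSus H.mat β H₁ =
          (c : ℂ) ^ 2 * (H.mean β (H.atConfig β fsEst)
            + (β : ℂ) ^ 2 / 8 * (H.mean β (H.atConfig β hsqEst)
              - 2 * H.mean β (H.atConfig β d0hEst)
              - H.mean β (H.atConfig β offEst) ^ 2))) := by
  refine ⟨⟨estProg, 200, fun β _ q E => ?_⟩, fun ι _ _ _ M H hH β hβ => ?_⟩
  · obtain ⟨h, hc⟩ := estProg_spec β q E
    exact ⟨hc, h⟩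
  have hF := PMR.isEstimator_fsEst hH hβ
  have hd := PMR.isEstimator_d0Est (β := β) hH
  have hg := PMR.isEstimator_offEst hH hβ
  have hh := PMR.isEstimator_hsqEst hH hβ
  have hm := PMR.isEstimator_d0hEst hH hβ
  refine ⟨hF, hd, hg, hh, hm, ?_, ?_⟩
  · rintro c _ rfl
    rw [fidSus_smul, hF.2.2.2, hd.2.2.2]
  · rintro c _ rfl
    rw [fidSus_smul, hF.2.2.2, hg.2.2.2, hh.2.2.2, hm.2.2.2]
    simp only [thermalAvg_evolve_sub]
    rw [integral_mul_add_const (continuous_thermalAvg_evolve _ _ _ _)]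
    ring
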